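/- **Setting.** Boolean formulas are built from atoms and $\bot,\top$ by $\neg,\wedge,\vee,\to,\leftrightarrow$. KLM formulas are $\varphi ::= \alpha \mid \alpha\mathrel{|\!\sim}\beta \mid \varphi\wedge\varphi$ with $\alpha,\beta$ Boolean. A conjunction stands for the set of its conjuncts and a Boolean formula $\alpha$ for the defeasible implication $\neg\alpha\mathrel{|\!\sim}\bot$; in this way every KLM formula and every finite KLM knowledge base has a finite set of defeasible implications. The *materialization* of $\alpha\mathrel{|\!\sim}\beta$ is $\alpha\to\beta$. *Propositional rational closure* ($\mathrm{RCProp}$). For a finite set of defeasible implications with set of materializations $E_0$ put $E_{i+1}=\{\alpha\to\beta\in E_i : E_i\models\neg\alpha\}$, let $m$ be least with $E_m=E_{m+1}$, and put $R_i=E_i\setminus E_{i+1}$ for $i<m$ and $R_\infty=E_m$. $\mathrm{RCProp}$ accepts $\alpha\mathrel{|\!\sim}\beta$ iff $R_\infty\cup R\models\alpha\to\beta$, where $R$ is obtained from $R_0\cup\dots\cup R_{m-1}$ by removing $R_0,R_1,\dots$ successively as long as $R_\infty\cup R\models\neg\alpha$ and $R\neq\emptyset$. It accepts a KLM formula iff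 it accepts all its defeasible implications. *Standpoint knowledge bases.* There is a universal standpoint $*$ and there are named standpoints. A standpoint knowledge base $\mathcal K$ in normal form is a finite set of formulas $\Box_s\varphi$ and $\Diamond_s\varphi$ ($\varphi$ a KLM formula) and sharpening statements $s\preceq t$. Let $S$ be the set of standpoints occurring in $\mathcal K$. Write $s\preceq^+t$ if $t=s$, or $t=*$, or there is a chain of statements $s\preceq t_1,\,t_1\preceq t_2,\dots,t_n\preceq t$ (possibly the single statement $s\preceq t$) in $\mathcal K$. Put $K_s=\{\varphi : \Box_t\varphi\in\mathcal K,\ s\preceq^+t\}$ and, for $\Diamond_s\varphi\in\mathcal K$, $K_s^{\varphi}=K_s\cup\{\varphi\}$. $\mathrm{Know}_s$ consists of the knowledge bases $K_t$ for $t\in S$ with $t\preceq^+s$, and $K_t^\varphi$ for $t\in S$ with $t\preceq^+ s$ and $\Diamond_t\varphi\in\mathcal K$; for $s=*$ the knowledge base $K_t$ with index $t=*$ is left out. A query in normal form is a conjunction of formulas $\Box_s\varphi$, $\Diamond_s\varphi$ all of whose standpoints lie in $S\cup\{*\}$. $\mathrm{RCStandpoint}$ accepts $\Box_s\varphi$ (resp.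 $\Diamond_s\varphi$) iff $\mathrm{RCProp}(K,\varphi)$ accepts for all (resp. some) $K\in\mathrm{Know}_s$, and accepts a conjunction iff it accepts both conjuncts. A *Horn clause* is a formula that becomes, after $\to$ is rewritten by $\neg,\vee$ and negations are pushed inwards, a disjunction of literals (and possibly truth constants) with at most one positive literal. Instances are encoded in the usual way, with atoms and standpoints named by binary words. A decision problem is identified with the set of encodings of its yes-instances. **Theorem.** 1. The problem, given a standpoint knowledge base $\mathcal K$ in normal form and a query $\psi$ in normal form, whether $\mathrm{RCStandpoint}(\mathcal K,\psi)$ accepts, is in $\mathrm{P}^{\mathrm{NP}}$. So is the problem, given a finite KLM knowledge base $K$ and a KLM formula $\varphi$, whether $\mathrm{RCProp}(K,\varphi)$ accepts. 2. Restricted to instances in which the materialization of every defeasible implication (including $\neg\alpha\mathrel{|\!\sim}\bot$ for each Boolean formula $\alpha$ used as a KLM formula) in $\mathcal K$ and in $\psi$ is a Horn clause, the problem whether $\mathrm{RCStandpoint}(\mathcal K,\psi)$ accepts is in $\mathrm{P}$. -/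

import Mathlib

namespace DRSL

/-! ## Machine model: programs on binary trees, with a time measure and an oracle -/

/-- Data are finite binary trees with unlabelled leaves. -/
inductive Data where
  | nil : Data
  | cons : Data → Data → Data

namespace Data

/-- The size of a tree: its number of nodes, leaves included. -/
def size : Data → ℕ
  | nil => 1
  | cons a b => a.size + b.size + 1

/-- Left subtree (a leaf if there is none). -/
def fst : Data → Data
  | nil => nil
  | cons a _ => a

/-- Right subtree (a leaf if there is none). -/
def snd : Data → Data
  | nil => nil
  | cons _ b => b

/-- Truth values as data: `false` is the leaf, `true` is a tree that is not the leaf. -/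
def ofBool : Bool → Data
  | false => nil
  | true => cons nil nil

/-- A list of data as a right comb. -/
def ofList : List Data → Data
  | [] => nil
  | a :: l => cons a (ofList l)

/-- Small unary numerals, only used as tags of constructors. -/
def tag : ℕ → Data
  | 0 => nil
  | n + 1 => cons nil (tag n)

end Data

/-- While-programs on binary trees with access to an oracle. A program transforms the tree in its
single register. -/
inductive Prog where
  /-- leave the register unchanged -/
  | id : Prog
  /-- write a leaf -/
  | nil : Prog
  /-- left subtree -/
  | fst : Prog
  /-- right subtree -/
  | snd : Prog
  /-- run both programs on the register and pair the results -/
  | pair (f g : Prog) : Prog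
  /-- run `f` and then `g` -/
  | seq (f g : Prog) : Prog
  /-- run `f` if the result of `c` is not a leaf, and `g` otherwise -/
  | ite (c f g : Prog) : Prog
  /-- repeat `f` as long as the result of `c` on the register is not a leaf -/
  | loop (c f : Prog) : Prog
  /-- ask the oracle whether the register belongs to it -/
  | query : Prog

/-- `P.Runs O x y t`: with oracle `O`, the program `P` started on `x` halts with result `y` in
time `t`. Every elementary operation takes as much time as the size of the tree it is applied to,
the oracle query three units more for writing its answer, and every control operation takes one
further unit. So trees are paid for by their size: neither the size of the start value nor that of
the result exceeds the running time. -/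
inductive Prog.Runs (O : Set Data) : Prog → Data → Data → ℕ → Prop where
  | id (x : Data) : Runs O Prog.id x x x.size
  | nil (x : Data) : Runs O Prog.nil x Data.nil x.size
  | fst (x : Data) : Runs O Prog.fst x x.fst x.size
  | snd (x : Data) : Runs O Prog.snd x x.snd x.size
  | pair {f g : Prog} {x y z : Data} {t u : ℕ} :
      Runs O f x y t → Runs O g x z u → Runs O (Prog.pair f g) x (Data.cons y z) (t + u + 1)
  | seq {f g : Prog} {x y z : Data} {t u : ℕ} :
      Runs O f x y t → Runs O g y z u → Runs O (Prog.seq f g) x z (t + u + 1)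
  | ite_then {c f g : Prog} {x y a b : Data} {t u : ℕ} :
      Runs O c x (Data.cons a b) t → Runs O f x y u → Runs O (Prog.ite c f g) x y (t + u + 1)
  | ite_else {c f g : Prog} {x y : Data} {t u : ℕ} :
      Runs O c x Data.nil t → Runs O g x y u → Runs O (Prog.ite c f g) x y (t + u + 1)
  | loop_stop {c f : Prog} {x : Data} {t : ℕ} :
      Runs O c x Data.nil t → Runs O (Prog.loop c f) x x (t + 1)
  | loop_step {c f : Prog} {x y z a b : Data} {t u v : ℕ} :
      Runs O c x (Data.cons a b) t → Runs O f x y u → Runs O (Prog.loop c f) y z v →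
      Runs O (Prog.loop c f) x z (t + u + v + 1)
  | query_yes {x : Data} : x ∈ O → Runs O Prog.query x (Data.ofBool true) (x.size + 3)
  | query_no {x : Data} : x ∉ O → Runs O Prog.query x (Data.ofBool false) (x.size + 3)

/-- The decision problems that some program with oracle `O` decides in polynomial time. -/
def PolyTimeWith (O : Set Data) : Set (Set Data) :=
  {L | ∃ (P : Prog) (p : Polynomial ℕ), ∀ x : Data, ∃ t ≤ p.eval x.size,
    (x ∈ L → P.Runs O x (Data.ofBool true) t) ∧ (x ∉ L → P.Runs O x (Data.ofBool false) t)}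

/-- The class P. (The empty oracle rejects every query, so it is of no use.) -/
def PTime : Set (Set Data) := PolyTimeWith ∅

/-- The class NP: membership has certificates of polynomial size, checkable in polynomial time. -/
def NPTime : Set (Set Data) :=
  {L | ∃ R ∈ PTime, ∃ p : Polynomial ℕ, ∀ x : Data,
    x ∈ L ↔ ∃ w : Data, w.size ≤ p.eval x.size ∧ Data.cons x w ∈ R}

/-- The class P^NP: polynomial time with an oracle for some problem in NP. -/
def PTimeNP : Set (Set Data) := {L | ∃ A ∈ NPTime, L ∈ PolyTimeWith A}

/-! ## Propositional KLM logic -/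

/-- Names of atoms and of standpoints are binary words. -/
abbrev Name := List Bool

/-- Boolean formulas. -/
inductive Fml where
  | atom (p : Name) : Fml
  | bot : Fml
  | top : Fml
  | neg (a : Fml) : Fml
  | and (a b : Fml) : Fml
  | or (a b : Fml) : Fml
  | imp (a b : Fml) : Fml
  | iff (a b : Fml) : Fml
  deriving DecidableEq

/-- Truth value of a Boolean formula under a valuation. -/
def Fml.eval (v : Name → Bool) : Fml → Bool
  | atom p => v p
  | bot => false
  | top => true
  | neg a => !a.eval v
  | and a b => a.eval v && b.eval v
  | or a b => a.eval v || b.eval v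
  | imp a b => !a.eval v || b.eval v
  | iff a b => a.eval v == b.eval v

/-- A defeasible implication `ante |~ conc`. -/
structure Cond where
  ante : Fml
  conc : Fml
  deriving DecidableEq

/-- The materialization `α → β` of `α |~ β`. -/
def Cond.mat (c : Cond) : Fml := Fml.imp c.ante c.conc

/-- KLM formulas: Boolean formulas, defeasible implications, and conjunctions. -/
inductive KLM where
  | bool (a : Fml) : KLM
  | cond (c : Cond) : KLM
  | and (φ χ : KLM) : KLM
  deriving DecidableEq

/-- The defeasible implications of a KLM formula: conjunctions are split into their conjuncts, and a
Boolean formula `α` is turned into `¬α |~ ⊥`. -/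
def KLM.conds : KLM → Finset Cond
  | bool a => {⟨Fml.neg a, Fml.bot⟩}
  | cond c => {c}
  | and φ χ => φ.conds ∪ χ.conds

/-- Classical entailment of `a` from the materializations of the members of `E`. -/
def Entails (E : Finset Cond) (a : Fml) : Prop :=
  ∀ v : Name → Bool, (∀ c ∈ E, c.mat.eval v = true) → a.eval v = true

/-! ## Propositional rational closure -/

open Classical in
/-- The members of `E` whose antecedent is refuted by the materializations of `E`. -/
noncomputable def exceptional (E : Finset Cond) : Finset Cond :=
  E.filter fun c => Entails E (Fml.neg c.ante)

theorem exceptional_subset (E : Finset Cond) : exceptional E ⊆ E := by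
  classical
  exact Finset.filter_subset _ _

/-- The algorithm `BaseRank`, started with the current set `E = E_i`. It returns the list of the
finite levels `R_i, R_{i+1}, …` and the infinite level `R_∞`. (A set of materializations
`α → β` is represented by the set of the corresponding implications `α |~ β`.) -/
noncomputable def baseRank (E : Finset Cond) : List (Finset Cond) × Finset Cond :=
  if h : exceptional E = E then
    (if E = ∅ then [] else [E \ exceptional E], E)
  else
    ((E \ exceptional E) :: (baseRank (exceptional E)).1, (baseRank (exceptional E)).2)
termination_by E.card
decreasing_by
  all_goals exact Finset.card_lt_card (Finset.ssubset_iff_subset_ne.mpr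
    ⟨exceptional_subset E, h⟩)

open Classical in
/-- The loop of `RCProp`: as long as `R_∞ ∪ R` refutes `a` and `R` is not empty, remove the next
level from `R`. -/
noncomputable def rcLoop (a : Fml) (Rinf : Finset Cond) :
    Finset Cond → List (Finset Cond) → Finset Cond
  | R, [] => R
  | R, r :: rs =>
    if Entails (Rinf ∪ R) (Fml.neg a) ∧ R ≠ ∅ then rcLoop a Rinf (R \ r) rs else R

/-- The algorithm `RCProp` for a set of defeasible implications and a defeasible implication. -/
def RCPropCond (E : Finset Cond) (c : Cond) : Prop :=
  let levels := (baseRank E).1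
  let Rinf := (baseRank E).2
  let R := levels.foldr (· ∪ ·) ∅
  Entails (Rinf ∪ rcLoop c.ante Rinf R levels) c.mat

/-- The algorithm `RCProp` for a KLM knowledge base and a KLM formula. -/
def RCProp (B : Finset KLM) (φ : KLM) : Prop :=
  ∀ c ∈ φ.conds, RCPropCond (B.biUnion KLM.conds) c

/-! ## Defeasible restricted standpoint logic -/

/-- Standpoint symbols: the universal standpoint `*` and the named standpoints. -/
inductive Standpoint where
  | univ : Standpoint
  | named (s : Name) : Standpoint
  deriving DecidableEq

/-- Members of a standpoint knowledge base in normal form: `□_s φ`, `◇_s φ`, and the sharpening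
statements `s ⪯ t`. -/
inductive Item where
  | box (s : Standpoint) (φ : KLM) : Item
  | dia (s : Standpoint) (φ : KLM) : Item
  | sharp (s t : Standpoint) : Item
  deriving DecidableEq

/-- Standpoint formulas in normal form: conjunctions of formulas `□_s φ` and `◇_s φ`. -/
inductive Query where
  | box (s : Standpoint) (φ : KLM) : Query
  | dia (s : Standpoint) (φ : KLM) : Query
  | and (ψ χ : Query) : Query

/-- Standpoints occurring in a member of a knowledge base. -/
def Item.standpoints : Item → Finset Standpoint
  | box s _ => {s}
  | dia s _ => {s}
  | sharp s t => {s, t}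

/-- Standpoints occurring in a query. -/
def Query.standpoints : Query → Finset Standpoint
  | box s _ => {s}
  | dia s _ => {s}
  | and ψ χ => ψ.standpoints ∪ χ.standpoints

/-- The set `S` of the standpoints occurring in a knowledge base. -/
def standpoints (K : Finset Item) : Finset Standpoint := K.biUnion Item.standpoints

/-- The relation `s ⪯⁺ t` of a knowledge base. -/
def SharpPlus (K : Finset Item) (s t : Standpoint) : Prop :=
  t = s ∨ t = Standpoint.univ ∨ Relation.TransGen (fun a b => Item.sharp a b ∈ K) s t

open Classical in
/-- The KLM knowledge base `K_s`: all `φ` such that `□_t φ` is in `K` for some `t` with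
`s ⪯⁺ t`. -/
noncomputable def boxBase (K : Finset Item) (s : Standpoint) : Finset KLM :=
  K.biUnion fun i => match i with
    | Item.box t φ => if SharpPlus K s t then {φ} else ∅
    | _ => ∅

/-- `Know_s`: the knowledge bases `K_t` and `K_t^φ = K_t ∪ {φ}`, for `◇_t φ` in `K`, where
`t ∈ S` and `t ⪯⁺ s`; only `Know_*` omits the knowledge base `K_*`. -/
def know (K : Finset Item) (s : Standpoint) : Set (Finset KLM) :=
  {B | ∃ t ∈ standpoints K, SharpPlus K t s ∧
    ((¬(s = Standpoint.univ ∧ t = Standpoint.univ) ∧ B = boxBase K t) ∨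
      ∃ φ, Item.dia t φ ∈ K ∧ B = insert φ (boxBase K t))}

/-- The algorithm `RCStandpoint`. -/
def RCStandpoint (K : Finset Item) : Query → Prop
  | Query.box s φ => ∀ B ∈ know K s, RCProp B φ
  | Query.dia s φ => ∃ B ∈ know K s, RCProp B φ
  | Query.and ψ χ => RCStandpoint K ψ ∧ RCStandpoint K χ

/-! ## Horn clauses -/

/-- `IsClause true a`: after `→` is rewritten and negations are pushed inwards, `a` is a disjunction
of literals and truth constants. `IsClause false a`: the same for `¬a`. -/
def Fml.IsClause : Bool → Fml → Prop
  | _, atom _ => True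
  | _, bot => True
  | _, top => True
  | b, neg a => a.IsClause (!b)
  | true, and _ _ => False
  | false, and a c => a.IsClause false ∧ c.IsClause false
  | true, or a c => a.IsClause true ∧ c.IsClause true
  | false, or _ _ => False
  | true, imp a c => a.IsClause false ∧ c.IsClause true
  | false, imp _ _ => False
  | _, iff _ _ => False

/-- The atoms with a positive occurrence in `a` (for `true`) or in `¬a` (for `false`); used for
formulas without `↔`. -/
def Fml.posAtoms : Bool → Fml → Finset Name
  | true, atom p => {p}
  | false, atom _ => ∅
  | _, bot => ∅
  | _, top => ∅
  | b, neg a => a.posAtoms (!b)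
  | b, and a c => a.posAtoms b ∪ c.posAtoms b
  | b, or a c => a.posAtoms b ∪ c.posAtoms b
  | b, imp a c => a.posAtoms (!b) ∪ c.posAtoms b
  | _, iff _ _ => ∅

/-- Horn clauses: clauses with at most one positive literal. -/
def Fml.IsHorn (a : Fml) : Prop := a.IsClause true ∧ (a.posAtoms true).card ≤ 1

/-- The materialization of every defeasible implication of `φ` is a Horn clause. -/
def KLM.IsHorn (φ : KLM) : Prop := ∀ c ∈ φ.conds, c.mat.IsHorn

/-- The Horn condition for a member of a knowledge base. -/
def Item.IsHorn : Item → Prop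
  | box _ φ => φ.IsHorn
  | dia _ φ => φ.IsHorn
  | sharp _ _ => True

/-- The Horn condition for a query. -/
def Query.IsHorn : Query → Prop
  | box _ φ => φ.IsHorn
  | dia _ φ => φ.IsHorn
  | and ψ χ => ψ.IsHorn ∧ χ.IsHorn

/-! ## Instances as data, and the decision problems -/

/-- Encoding of names. -/
def encName (w : Name) : Data := Data.ofList (w.map Data.ofBool)

/-- Encoding of Boolean formulas. -/
def Fml.enc : Fml → Data
  | atom p => Data.cons (Data.tag 0) (encName p)
  | bot => Data.cons (Data.tag 1) Data.nil
  | top => Data.cons (Data.tag 2) Data.nil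
  | neg a => Data.cons (Data.tag 3) a.enc
  | and a b => Data.cons (Data.tag 4) (Data.cons a.enc b.enc)
  | or a b => Data.cons (Data.tag 5) (Data.cons a.enc b.enc)
  | imp a b => Data.cons (Data.tag 6) (Data.cons a.enc b.enc)
  | iff a b => Data.cons (Data.tag 7) (Data.cons a.enc b.enc)

/-- Encoding of KLM formulas. -/
def KLM.enc : KLM → Data
  | bool a => Data.cons (Data.tag 0) a.enc
  | cond c => Data.cons (Data.tag 1) (Data.cons c.ante.enc c.conc.enc)
  | and φ χ => Data.cons (Data.tag 2) (Data.cons φ.enc χ.enc)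

/-- Encoding of standpoint symbols. -/
def Standpoint.enc : Standpoint → Data
  | univ => Data.nil
  | named s => Data.cons Data.nil (encName s)

/-- Encoding of members of a knowledge base. -/
def Item.enc : Item → Data
  | box s φ => Data.cons (Data.tag 0) (Data.cons s.enc φ.enc)
  | dia s φ => Data.cons (Data.tag 1) (Data.cons s.enc φ.enc)
  | sharp s t => Data.cons (Data.tag 2) (Data.cons s.enc t.enc)

/-- Encoding of queries. -/
def Query.enc : Query → Data
  | box s φ => Data.cons (Data.tag 0) (Data.cons s.enc φ.enc)
  | dia s φ => Data.cons (Data.tag 1) (Data.cons s.enc φ.enc)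
  | and ψ χ => Data.cons (Data.tag 2) (Data.cons ψ.enc χ.enc)

/-- An instance of standpoint entailment: a finite knowledge base, listed, and a query. -/
def encInstance (K : List Item) (ψ : Query) : Data :=
  Data.cons (Data.ofList (K.map Item.enc)) ψ.enc

/-- An instance of propositional entailment: a finite KLM knowledge base, listed, and a formula. -/
def encPropInstance (B : List KLM) (φ : KLM) : Data :=
  Data.cons (Data.ofList (B.map KLM.enc)) φ.enc

/-- Closed-world condition: apart from `*`, the query only uses standpoints named in `K`. -/
def ClosedWorld (K : Finset Item) (ψ : Query) : Prop :=
  ψ.standpoints ⊆ insert Standpoint.univ (standpoints K)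

/-- Entailment checking under propositional rational closure. -/
def rcPropProblem : Set Data :=
  {d | ∃ (B : List KLM) (φ : KLM), d = encPropInstance B φ ∧ RCProp B.toFinset φ}

/-- Entailment checking with `RCStandpoint`. -/
def rcStandpointProblem : Set Data :=
  {d | ∃ (K : List Item) (ψ : Query), d = encInstance K ψ ∧ ClosedWorld K.toFinset ψ ∧
    RCStandpoint K.toFinset ψ}

/-- Entailment checking with `RCStandpoint`, restricted to the instances in which the
materializations of all defeasible implications are Horn clauses. -/
def rcStandpointHornProblem : Set Data :=
  {d | ∃ (K : List Item) (ψ : Query), d = encInstance K ψ ∧ ClosedWorld K.toFinset ψ ∧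
    (∀ i ∈ K, i.IsHorn) ∧ ψ.IsHorn ∧ RCStandpoint K.toFinset ψ}

end DRSL

/-!
The algorithms are written as ordinary functions between types of formulas, lists and truth values,
and `PolyFun O f` says that a program with oracle `O` computes `f` on encodings in polynomial time.
Nothing is required of the program on trees that are not encodings, so an algorithm may rely on its
input being well-formed; well-formedness is tested once, at the top (`Recognizable`,
`mem_polyTimeWith`).

All iteration goes through one construction, `PolyFun.recursion`: a function that calls itself at
most twice, with a measure that bounds the number of calls and a bound on the sizes of all arguments
and values, is computed by a loop that maintains a stack of tasks and a stack of values. Equality of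
trees, folds over lists, iteration of bounded length and structural recursion on formulas are
instances, and `fun_prop` composes them.

Rational closure needs no ranks. The levels that `RCProp` has not yet removed, together with the
infinite level, always form one of the sets `E_i`; hence `RCProp` decides `α |~ β` by passing from
`E` to its exceptional part as long as the current set refutes `α`, and then testing the current set
for entailment of `α → β` (`union_rcLoop_eq`, `rcPropCond_iff`). These are at most `|E|` rounds of
at most `|E| + 1` entailment tests. The knowledge bases in `Know_s` are polynomially many, and the
relation `⪯⁺` is computed by saturation (`sat`). So `RCStandpoint` runs in polynomial time relative
to any test of entailment that is correct for the implications at hand (`Decides`,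
`rcStandpointB_eq_true`, `PolyFun.rcStandpointB`).

For the first part, the test asks an oracle for non-entailment, which is in NP: a certificate lists
those atoms of the instance that a countermodel makes true (`nonEntailment_mem_NPTime`). For the
second part, if `α → β` is a Horn clause, then so is `¬α`, and all tests ask whether Horn clauses
entail a clause `a`. Forward chaining from the negative atoms of `a` yields a set of atoms that is
true in every countermodel; `a` is entailed iff one of the clauses is false in the model given by
that set, or `a` is true there (`hornEntails_eq_true`).
-/

namespace DRSL

/-! ### Running times -/

namespace Data

@[simp] theorem size_nil : nil.size = 1 := rfl

@[simp] theorem size_cons (a b : Data) : (cons a b).size = a.size + b.size + 1 := rfl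

@[simp] theorem fst_cons (a b : Data) : (cons a b).fst = a := rfl

@[simp] theorem snd_cons (a b : Data) : (cons a b).snd = b := rfl

theorem size_pos (d : Data) : 1 ≤ d.size := by
  cases d <;> simp

theorem size_fst_le (d : Data) : d.fst.size ≤ d.size := by
  cases d
  · exact le_rfl
  · simp only [fst_cons, size_cons]; omega

theorem size_snd_le (d : Data) : d.snd.size ≤ d.size := by
  cases d
  · exact le_rfl
  · simp only [snd_cons, size_cons]; omega

theorem size_ofBool_le (b : Bool) : (ofBool b).size ≤ 3 := by
  cases b <;> simp [ofBool]

end Data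

/-- Trees are paid for by their size, so the running time bounds the size of the result. -/
theorem Prog.Runs.size_le {O : Set Data} {P : Prog} {x y : Data} {t : ℕ} (h : P.Runs O x y t) :
    x.size ≤ t ∧ y.size ≤ t := by
  induction h with
  | id x => exact ⟨le_rfl, le_rfl⟩
  | nil x => exact ⟨le_rfl, x.size_pos⟩
  | fst x => exact ⟨le_rfl, x.size_fst_le⟩
  | snd x => exact ⟨le_rfl, x.size_snd_le⟩
  | query_yes _ => exact ⟨by omega, by simp [Data.ofBool]⟩
  | query_no _ => exact ⟨by omega, by simp [Data.ofBool]⟩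
  | _ => (try simp only [Data.size_cons] at *); omega

/-- `P.Within O x y n`: started on `x`, the program halts with result `y` in time at most `n`. -/
def Prog.Within (O : Set Data) (P : Prog) (x y : Data) (n : ℕ) : Prop :=
  ∃ t ≤ n, P.Runs O x y t

namespace Prog.Within

variable {O : Set Data} {P Q R : Prog} {x y z a b : Data} {m n k : ℕ}

theorem mono (h : P.Within O x y m) (hmn : m ≤ n) : P.Within O x y n :=
  let ⟨t, ht, hr⟩ := h
  ⟨t, ht.trans hmn, hr⟩

theorem size_le (h : P.Within O x y n) : y.size ≤ n :=
  let ⟨_, ht, hr⟩ := h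
  hr.size_le.2.trans ht

theorem id : Prog.id.Within O x x x.size := ⟨_, le_rfl, .id x⟩

theorem nil : Prog.nil.Within O x Data.nil x.size := ⟨_, le_rfl, .nil x⟩

theorem fst : Prog.fst.Within O x x.fst x.size := ⟨_, le_rfl, .fst x⟩

theorem snd : Prog.snd.Within O x x.snd x.size := ⟨_, le_rfl, .snd x⟩

theorem pair (h : P.Within O x y m) (h' : Q.Within O x z n) :
    (Prog.pair P Q).Within O x (Data.cons y z) (m + n + 1) :=
  let ⟨_, ht, hr⟩ := h
  let ⟨_, ht', hr'⟩ := h'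
  ⟨_, by omega, .pair hr hr'⟩

theorem seq (h : P.Within O x y m) (h' : Q.Within O y z n) :
    (Prog.seq P Q).Within O x z (m + n + 1) :=
  let ⟨_, ht, hr⟩ := h
  let ⟨_, ht', hr'⟩ := h'
  ⟨_, by omega, .seq hr hr'⟩

theorem ite_then (h : P.Within O x (Data.cons a b) m) (h' : Q.Within O x y n) :
    (Prog.ite P Q R).Within O x y (m + n + 1) :=
  let ⟨_, ht, hr⟩ := h
  let ⟨_, ht', hr'⟩ := h'
  ⟨_, by omega, .ite_then hr hr'⟩

theorem ite_else (h : P.Within O x Data.nil m) (h' : R.Within O x y n) :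
    (Prog.ite P Q R).Within O x y (m + n + 1) :=
  let ⟨_, ht, hr⟩ := h
  let ⟨_, ht', hr'⟩ := h'
  ⟨_, by omega, .ite_else hr hr'⟩

theorem loop_stop (h : P.Within O x Data.nil m) : (Prog.loop P Q).Within O x x (m + 1) :=
  let ⟨_, ht, hr⟩ := h
  ⟨_, by omega, Prog.Runs.loop_stop hr⟩

theorem loop_step (h : P.Within O x (Data.cons a b) m) (h' : Q.Within O x y n)
    (h'' : (Prog.loop P Q).Within O y z k) : (Prog.loop P Q).Within O x z (m + n + k + 1) :=
  let ⟨_, ht, hr⟩ := h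
  let ⟨_, ht', hr'⟩ := h'
  let ⟨_, ht'', hr''⟩ := h''
  ⟨_, by omega, .loop_step hr hr' hr''⟩

end Prog.Within

/-! ### Encodings and polynomial-time functions between encoded types -/

/-- Types whose elements are written down as trees. -/
class Enc (α : Type) where
  /-- the tree that stands for an element -/
  enc : α → Data
  /-- different elements have different trees -/
  enc_injective : Function.Injective enc

open Enc

instance : Enc Data := ⟨id, Function.injective_id⟩

theorem Data.ofBool_injective : Function.Injective Data.ofBool := by
  intro a b h
  cases a <;> cases b <;> simp_all [Data.ofBool]

instance : Enc Bool := ⟨Data.ofBool, Data.ofBool_injective⟩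

instance : Enc Unit := ⟨fun _ => Data.nil, fun _ _ _ => rfl⟩

instance {α β : Type} [Enc α] [Enc β] : Enc (α × β) where
  enc p := Data.cons (enc p.1) (enc p.2)
  enc_injective := by
    rintro ⟨a, b⟩ ⟨c, d⟩ h
    injection h with h₁ h₂
    exact Prod.ext (enc_injective h₁) (enc_injective h₂)

theorem Data.ofList_injective : Function.Injective Data.ofList := by
  intro a
  induction a with
  | nil => intro b h; cases b with
    | nil => rfl
    | cons => simp [Data.ofList] at h
  | cons x a ih => intro b h; cases b with
    | nil => simp [Data.ofList] at h
    | cons y b =>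
      simp only [Data.ofList, Data.cons.injEq] at h
      rw [h.1, ih h.2]

instance {α : Type} [Enc α] : Enc (List α) where
  enc l := Data.ofList (l.map enc)
  enc_injective := Data.ofList_injective.comp (List.map_injective_iff.mpr enc_injective)

instance {α : Type} [Enc α] {p : α → Prop} : Enc {a // p a} where
  enc a := enc a.1
  enc_injective := enc_injective.comp Subtype.val_injective

/-- The size of the tree that stands for `a`. -/
def esize {α : Type} [Enc α] (a : α) : ℕ := (enc a).size

section sizes

variable {α β : Type} [Enc α] [Enc β]

@[simp] theorem enc_data (d : Data) : enc d = d := rfl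

@[simp] theorem enc_bool (b : Bool) : enc b = Data.ofBool b := rfl

@[simp] theorem enc_pair (a : α) (b : β) : enc (a, b) = Data.cons (enc a) (enc b) := rfl

@[simp] theorem enc_nil : enc ([] : List α) = Data.nil := rfl

@[simp] theorem enc_cons (a : α) (l : List α) : enc (a :: l) = Data.cons (enc a) (enc l) := rfl

@[simp] theorem enc_subtype {p : α → Prop} (a : {a // p a}) : enc a = enc a.1 := rfl

@[simp] theorem esize_pair (a : α) (b : β) : esize (a, b) = esize a + esize b + 1 := rfl

@[simp] theorem esize_nil : esize ([] : List α) = 1 := rfl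

@[simp] theorem esize_cons (a : α) (l : List α) : esize (a :: l) = esize a + esize l + 1 := rfl

@[simp] theorem esize_subtype {p : α → Prop} (a : {a // p a}) : esize a = esize a.1 := rfl

theorem esize_bool_le (b : Bool) : esize b ≤ 3 := Data.size_ofBool_le b

theorem esize_pos (a : α) : 1 ≤ esize a := Data.size_pos _

theorem esize_append (l m : List α) : esize (l ++ m) + 1 = esize l + esize m := by
  induction l with
  | nil => simp; omega
  | cons a l ih => simp only [List.cons_append, esize_cons]; omega

theorem esize_sublist {l m : List α} (h : l.Sublist m) : esize l ≤ esize m := by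
  induction h with
  | slnil => exact le_rfl
  | cons a _ ih => simp only [esize_cons]; omega
  | cons_cons a _ ih => simp only [esize_cons]; omega

theorem length_le_esize (l : List α) : l.length ≤ esize l := by
  induction l with
  | nil => simp
  | cons a l ih => simp only [esize_cons, List.length_cons]; omega

theorem esize_le_of_forall_le {n : ℕ} {l : List α} (h : ∀ a ∈ l, esize a ≤ n) :
    esize l ≤ l.length * (n + 1) + 1 := by
  induction l with
  | nil => simp
  | cons a l ih =>
    have h₁ := h a (by simp)
    have h₂ := ih fun b hb => h b (by simp [hb])
    simp only [esize_cons, List.length_cons, add_mul]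
    omega

end sizes

theorem eval_mono (p : Polynomial ℕ) {m n : ℕ} (h : m ≤ n) : p.eval m ≤ p.eval n := by
  induction p using Polynomial.induction_on' with
  | add p q hp hq => simp only [Polynomial.eval_add]; omega
  | monomial k c =>
    simp only [Polynomial.eval_monomial]
    gcongr

/-- `f` is computed, on encodings, by a program with oracle `O` in polynomial time. Nothing is
required of the program on trees that encode no element of the domain. -/
@[fun_prop]
def PolyFun (O : Set Data) {α β : Type} [Enc α] [Enc β] (f : α → β) : Prop :=
  ∃ (P : Prog) (p : Polynomial ℕ), ∀ a, P.Within O (enc a) (enc (f a)) (p.eval (esize a))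

namespace PolyFun

variable {O : Set Data} {α β γ δ : Type} [Enc α] [Enc β] [Enc γ] [Enc δ]

theorem esize_le {f : α → β} (hf : PolyFun O f) :
    ∃ p : Polynomial ℕ, ∀ a, esize (f a) ≤ p.eval (esize a) :=
  let ⟨_, p, h⟩ := hf
  ⟨p, fun a => (h a).size_le⟩

/-- A change of type that leaves the encoding as it is costs nothing. -/
theorem retype {f : α → β} (h : ∀ a, enc (f a) = enc a) : PolyFun O f :=
  ⟨Prog.id, Polynomial.X, fun a => by
    rw [h a, Polynomial.eval_X]
    exact .id⟩

@[fun_prop]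
theorem id : PolyFun O (fun a : α => a) := retype fun _ => rfl

@[fun_prop]
theorem comp {f : β → γ} {g : α → β} (hf : PolyFun O f) (hg : PolyFun O g) :
    PolyFun O (fun a => f (g a)) := by
  obtain ⟨P, p, hP⟩ := hf
  obtain ⟨Q, q, hQ⟩ := hg
  refine ⟨Prog.seq Q P, q + p.comp q + 1, fun a => ((hQ a).seq (hP (g a))).mono ?_⟩
  have := eval_mono p (hQ a).size_le
  simp only [Polynomial.eval_add, Polynomial.eval_comp, Polynomial.eval_one]
  unfold esize at *
  omega

@[fun_prop]
theorem prodMk {f : α → β} {g : α → γ} (hf : PolyFun O f) (hg : PolyFun O g) :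
    PolyFun O (fun a => (f a, g a)) := by
  obtain ⟨P, p, hP⟩ := hf
  obtain ⟨Q, q, hQ⟩ := hg
  refine ⟨Prog.pair P Q, p + q + 1, fun a => ((hP a).pair (hQ a)).mono ?_⟩
  simp

theorem dataFst : PolyFun O Data.fst :=
  ⟨Prog.fst, Polynomial.X, fun a => by
    rw [Polynomial.eval_X]
    exact Prog.Within.fst⟩

theorem dataSnd : PolyFun O Data.snd :=
  ⟨Prog.snd, Polynomial.X, fun a => by
    rw [Polynomial.eval_X]
    exact Prog.Within.snd⟩

/-- The function `f` is polynomial-time if it is so on encodings. -/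
theorem of_data {f : α → β} {g : Data → Data} (hg : PolyFun O g)
    (h : ∀ a, enc (f a) = g (enc a)) : PolyFun O f := by
  obtain ⟨P, p, hP⟩ := hg
  exact ⟨P, p, fun a => by rw [h a]; exact hP (enc a)⟩

theorem of_enc {f : α → β} {g : α → γ} (hg : PolyFun O g)
    (h : ∀ a, enc (f a) = enc (g a)) : PolyFun O f := by
  obtain ⟨P, p, hP⟩ := hg
  exact ⟨P, p, fun a => by rw [h a]; exact hP a⟩

@[fun_prop]
theorem enc_fun : PolyFun O (fun a : α => enc a) := retype fun _ => rfl

@[fun_prop]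
theorem fst : PolyFun O (fun p : α × β => p.1) := of_data dataFst fun _ => rfl

@[fun_prop]
theorem snd : PolyFun O (fun p : α × β => p.2) := of_data dataSnd fun _ => rfl

@[fun_prop]
theorem data_fst {f : α → Data} (hf : PolyFun O f) :
    PolyFun O (fun a => (f a).fst) := dataFst.comp hf

@[fun_prop]
theorem data_snd {f : α → Data} (hf : PolyFun O f) :
    PolyFun O (fun a => (f a).snd) := dataSnd.comp hf

@[fun_prop]
theorem data_cons {f g : α → Data} (hf : PolyFun O f) (hg : PolyFun O g) :
    PolyFun O (fun a => Data.cons (f a) (g a)) := of_enc (hf.prodMk hg) fun _ => rfl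

@[fun_prop]
theorem val {p : α → Prop} : PolyFun O (fun a : {a // p a} => a.1) := retype fun _ => rfl

@[fun_prop]
theorem const (b : β) : PolyFun O (fun _ : α => b) := by
  have key : ∀ d : Data, PolyFun O (fun _ : α => d) := by
    intro d
    induction d with
    | nil => exact ⟨Prog.nil, Polynomial.X, fun a => by
      rw [Polynomial.eval_X]
      exact Prog.Within.nil⟩
    | cons x y hx hy => exact of_enc (hx.prodMk hy) fun _ => rfl
  exact of_enc (key (enc b)) fun _ => rfl

/-- Case distinction; either branch need only be defined where it is used. -/
theorem dcond {c : α → Bool} {f : α → β} (hc : PolyFun O c)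
    (ht : PolyFun O (fun a : {a // c a = true} => f a.1))
    (he : PolyFun O (fun a : {a // c a = false} => f a.1)) : PolyFun O f := by
  obtain ⟨R, r, hR⟩ := hc
  obtain ⟨P, p, hP⟩ := ht
  obtain ⟨Q, q, hQ⟩ := he
  refine ⟨Prog.ite R P Q, r + p + q + 1, fun a => ?_⟩
  cases h : c a with
  | true =>
    have h₁ := hR a
    rw [h] at h₁
    refine (h₁.ite_then (hP ⟨a, h⟩)).mono ?_
    simp only [Polynomial.eval_add, Polynomial.eval_one, esize_subtype]
    omega
  | false =>
    have h₁ := hR a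
    rw [h] at h₁
    refine (h₁.ite_else (hQ ⟨a, h⟩)).mono ?_
    simp only [Polynomial.eval_add, Polynomial.eval_one, esize_subtype]
    omega

@[fun_prop]
theorem cond {c : α → Bool} {f g : α → β} (hc : PolyFun O c) (hf : PolyFun O f)
    (hg : PolyFun O g) : PolyFun O (fun a => bif c a then f a else g a) :=
  dcond hc (of_enc (hf.comp val) fun a => by simp [a.2]) (of_enc (hg.comp val) fun a => by
    simp [a.2])

@[fun_prop]
theorem band {c d : α → Bool} (hc : PolyFun O c) (hd : PolyFun O d) :
    PolyFun O (fun a => c a && d a) :=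
  of_enc (hc.cond hd (const false)) fun a => by cases c a <;> rfl

@[fun_prop]
theorem bor {c d : α → Bool} (hc : PolyFun O c) (hd : PolyFun O d) :
    PolyFun O (fun a => c a || d a) :=
  of_enc (hc.cond (const true) hd) fun a => by cases c a <;> rfl

@[fun_prop]
theorem bnot {c : α → Bool} (hc : PolyFun O c) : PolyFun O (fun a => !c a) :=
  of_enc (hc.cond (const false) (const true)) fun a => by cases c a <;> rfl

end PolyFun

/-! ### Recursion on a stack -/

namespace Recursion

/-- The task of computing the recursive function at (the encoding) `z`. -/
def call (z : Data) : Data := Data.cons Data.nil z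

/-- The task of combining the two topmost values into the value at `z`. -/
def merge (z : Data) : Data := Data.cons (Data.cons Data.nil Data.nil) z

/-- The state of the stack machine: the tasks still to be done, and the values already computed. -/
def state (todo vals : Data) : Data := Data.cons todo vals

/-- The argument of the topmost task. -/
def argProg : Prog := .seq .fst (.seq .fst .snd)

/-- The tasks below the topmost one. -/
def restProg : Prog := .seq .fst .snd

/-- The constant program with value `merge z` on input `z` prepared by `P`. -/
def mergeProg (P : Prog) : Prog := .pair (.pair .nil .nil) P

/-- One step of the stack machine: a `call` at a leaf pushes a value, a `call` elsewhere is replaced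
by two calls and a `merge`, and a `merge` replaces two values by one. -/
def stepProg (leaf base l r comb : Prog) : Prog :=
  .ite (.seq .fst (.seq .fst .fst))
    (.pair restProg
      (.pair
        (.seq (.pair argProg (.pair (.seq .snd (.seq .snd .fst)) (.seq .snd .fst))) comb)
        (.seq .snd (.seq .snd .snd))))
    (.ite (.seq argProg leaf)
      (.pair restProg (.pair (.seq argProg base) .snd))
      (.pair
        (.pair (.pair .nil (.seq argProg l))
          (.pair (.pair .nil (.seq argProg r))
            (.pair (mergeProg argProg) restProg)))
        .snd))

variable {O : Set Data} {leaf base l r comb : Prog} {z rest vals u v w : Data} {n c N : ℕ}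

theorem within_arg {k : Data} :
    argProg.Within O (state (.cons (.cons k z) rest) vals) z
      (3 * (state (.cons (.cons k z) rest) vals).size) := by
  refine (Prog.Within.fst.seq (Prog.Within.fst.seq Prog.Within.snd)).mono ?_
  simp [state]; omega

theorem within_rest {k : Data} :
    restProg.Within O (state (.cons (.cons k z) rest) vals) rest
      (2 * (state (.cons (.cons k z) rest) vals).size) := by
  refine (Prog.Within.fst.seq Prog.Within.snd).mono ?_
  simp [state]; omega

theorem within_test {k : Data} :
    (Prog.seq .fst (.seq .fst .fst)).Within O (state (.cons (.cons k z) rest) vals) k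
      (3 * (state (.cons (.cons k z) rest) vals).size) := by
  refine (Prog.Within.fst.seq (Prog.Within.fst.seq Prog.Within.fst)).mono ?_
  simp [state]; omega

theorem within_leaf (hleaf : leaf.Within O z (.ofBool true) c) (hbase : base.Within O z v c)
    (hN : (state (.cons (call z) rest) vals).size ≤ N) :
    (stepProg leaf base l r comb).Within O (state (.cons (call z) rest) vals)
      (state rest (.cons v vals)) (20 * N + 5 * c + 20) := by
  refine (within_test.ite_else ((within_arg.seq hleaf).ite_then
    (within_rest.pair ((within_arg.seq hbase).pair .snd)))).mono ?_
  unfold call at hN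
  omega

theorem within_split (hleaf : leaf.Within O z (.ofBool false) c) (hl : l.Within O z u c)
    (hr : r.Within O z v c) (hN : (state (.cons (call z) rest) vals).size ≤ N) :
    (stepProg leaf base l r comb).Within O (state (.cons (call z) rest) vals)
      (state (.cons (call u) (.cons (call v) (.cons (merge z) rest))) vals)
      (30 * N + 5 * c + 40) := by
  refine (within_test.ite_else ((within_arg.seq hleaf).ite_else
    (((Prog.Within.nil.pair (within_arg.seq hl)).pair
      ((Prog.Within.nil.pair (within_arg.seq hr)).pair
        (((Prog.Within.nil.pair .nil).pair within_arg).pair within_rest))).pair .snd))).mono ?_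
  unfold call at hN
  omega

theorem within_merge (hcomb : comb.Within O (.cons z (.cons u v)) w c)
    (hN : (state (.cons (merge z) rest) (.cons v (.cons u vals))).size ≤ N) :
    (stepProg leaf base l r comb).Within O
      (state (.cons (merge z) rest) (.cons v (.cons u vals)))
      (state rest (.cons w vals)) (20 * N + 5 * c + 20) := by
  have h₁ : (Prog.seq .snd (.seq .snd .fst)).Within O
      (state (.cons (merge z) rest) (.cons v (.cons u vals))) u
      (3 * (state (.cons (merge z) rest) (.cons v (.cons u vals))).size) := by
    refine (Prog.Within.snd.seq (Prog.Within.snd.seq Prog.Within.fst)).mono ?_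
    simp [state]; omega
  have h₂ : (Prog.seq .snd (.seq .snd .snd)).Within O
      (state (.cons (merge z) rest) (.cons v (.cons u vals))) vals
      (3 * (state (.cons (merge z) rest) (.cons v (.cons u vals))).size) := by
    refine (Prog.Within.snd.seq (Prog.Within.snd.seq Prog.Within.snd)).mono ?_
    simp [state]; omega
  have h₃ : (Prog.seq .snd .fst).Within O
      (state (.cons (merge z) rest) (.cons v (.cons u vals))) v
      (2 * (state (.cons (merge z) rest) (.cons v (.cons u vals))).size) := by
    refine (Prog.Within.snd.seq Prog.Within.fst).mono ?_
    simp [state]; omega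
  refine (within_test.ite_then (within_rest.pair
    (((within_arg.pair (h₁.pair h₃)).seq hcomb).pair h₂))).mono ?_
  unfold merge at *
  omega

end Recursion

open Recursion in
/-- Recursion along a binary tree of calls. The call at `a` is a leaf, or it makes the two calls
`l a` and `r a`; the measure `μ` bounds the number of calls, and `S` bounds the sizes of all
arguments and values met below `a`. -/
theorem PolyFun.recursion {O : Set Data} {α β : Type} [Enc α] [Enc β] {leaf : α → Bool}
    {base : {a // leaf a = true} → β} {l r : {a // leaf a = false} → α}
    {comb : {a // leaf a = false} × β × β → β} (hleaf : PolyFun O leaf) (hbase : PolyFun O base)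
    (hl : PolyFun O l) (hr : PolyFun O r) (hcomb : PolyFun O comb) (R : α → β)
    (hR₁ : ∀ a, R a.1 = base a) (hR₂ : ∀ a, R a.1 = comb (a, R (l a), R (r a)))
    (μ S : α → ℕ) (q : Polynomial ℕ) (hμ : ∀ a, μ (l a) + μ (r a) < μ a.1)
    (hSl : ∀ a, S (l a) ≤ S a.1) (hSr : ∀ a, S (r a) ≤ S a.1)
    (hSa : ∀ a, esize a ≤ S a) (hSR : ∀ a, esize (R a) ≤ S a) (hSμ : ∀ a, μ a ≤ S a)
    (hSq : ∀ a, S a ≤ q.eval (esize a)) : PolyFun O R := by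
  obtain ⟨P₁, p₁, h₁⟩ := hleaf
  obtain ⟨P₂, p₂, h₂⟩ := hbase
  obtain ⟨P₃, p₃, h₃⟩ := hl
  obtain ⟨P₄, p₄, h₄⟩ := hr
  obtain ⟨P₅, p₅, h₅⟩ := hcomb
  set step := stepProg P₁ P₂ P₃ P₄ P₅
  -- `c s` bounds the cost of the five subprograms on arguments met below a call of size bound `s`
  let c : ℕ → ℕ := fun s => p₁.eval s + p₂.eval s + p₃.eval s + p₄.eval s + p₅.eval (3 * s + 2)
  -- A call leaves at most three tasks and one value of size `≤ s` (and some tags) behind at every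
  -- level of the recursion, of which there are at most `μ a`; so all states on the way are of size
  -- at most `N`.
  -- It takes at most `3 * μ a + 1` steps: one for a leaf, two for a split and a merge elsewhere.
  have main : ∀ s N k : ℕ, ∀ a : α, μ a ≤ k → S a ≤ s → ∀ rest vals : Data,
      rest.size + vals.size + (μ a + 1) * (4 * s + 20) ≤ N → ∀ z m,
      (Prog.loop .fst step).Within O (state rest (.cons (enc (R a)) vals)) z m →
      (Prog.loop .fst step).Within O (state (.cons (call (enc a)) rest) vals) z
        (m + (3 * μ a + 1) * (31 * N + 5 * c s + 41)) := by
    intro s N k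
    induction k with
    | zero =>
      intro a ha hs rest vals hN z m hm
      cases h : leaf a with
      | true =>
        have e₁ := h₁ a
        have e₂ := h₂ ⟨a, h⟩
        have ea := hSa a
        rw [h] at e₁
        rw [← hR₁ ⟨a, h⟩] at e₂
        have i₁ := eval_mono p₁ (ea.trans hs)
        have i₂ := eval_mono p₂ (ea.trans hs)
        have hsz : (state (.cons (call (enc a)) rest) vals).size ≤ N := by
          simp only [state, call, Data.size_cons, Data.size_nil]
          simp only [esize] at ea
          nlinarith
        have hb := within_leaf (l := P₃) (r := P₄) (comb := P₅) (vals := vals) (rest := rest)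
          (c := c s) (e₁.mono (by simp only [c]; omega))
          (e₂.mono (by simp only [c, esize_subtype] at *; omega)) hsz
        refine (Prog.Within.loop_step (Prog.Within.fst) hb hm).mono ?_
        nlinarith
      | false =>
        have := hμ ⟨a, h⟩
        simp only at this
        omega
    | succ k ih =>
      intro a ha hs rest vals hN z m hm
      have ea := hSa a
      have hsz : (state (.cons (call (enc a)) rest) vals).size ≤ N := by
        simp only [state, call, Data.size_cons, Data.size_nil]
        simp only [esize] at ea
        nlinarith
      have i₁ := eval_mono p₁ (ea.trans hs)
      have e₁ := h₁ a
      cases h : leaf a with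
      | true =>
        have e₂ := h₂ ⟨a, h⟩
        rw [h] at e₁
        rw [← hR₁ ⟨a, h⟩] at e₂
        have i₂ := eval_mono p₂ (ea.trans hs)
        have hb := within_leaf (l := P₃) (r := P₄) (comb := P₅) (vals := vals) (rest := rest)
          (c := c s) (e₁.mono (by simp only [c]; omega))
          (e₂.mono (by simp only [c, esize_subtype] at *; omega)) hsz
        refine (Prog.Within.loop_step (Prog.Within.fst) hb hm).mono ?_
        nlinarith
      | false =>
        have e₃ := h₃ ⟨a, h⟩
        have e₄ := h₄ ⟨a, h⟩
        have e₅ := h₅ (⟨a, h⟩, R (l ⟨a, h⟩), R (r ⟨a, h⟩))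
        have hμa := hμ ⟨a, h⟩
        have hl := (hSl ⟨a, h⟩).trans hs
        have hr := (hSr ⟨a, h⟩).trans hs
        rw [h] at e₁
        rw [← hR₂ ⟨a, h⟩] at e₅
        simp only [esize_subtype, esize_pair] at e₃ e₄ e₅ hμa hl hr
        set b := l ⟨a, h⟩
        set d := r ⟨a, h⟩
        have i₃ := eval_mono p₃ (ea.trans hs)
        have i₄ := eval_mono p₄ (ea.trans hs)
        have sb := (hSa b).trans hl
        have sd := (hSa d).trans hr
        have tb := (hSR b).trans hl
        have td := (hSR d).trans hr
        have i₅ := eval_mono p₅ (show esize a + (esize (R b) + esize (R d) + 1) + 1 ≤ 3 * s + 2 by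
          omega)
        have as := ea.trans hs
        have hN' : rest.size + vals.size + (4 * s + 20) + (μ b + μ d + 1) * (4 * s + 20) ≤ N := by
          nlinarith
        have nb : (μ b + 1) * (4 * s + 20) ≤ (μ b + μ d + 1) * (4 * s + 20) := by
          gcongr; omega
        have nd : (μ d + 1) * (4 * s + 20) ≤ (μ b + μ d + 1) * (4 * s + 20) := by
          gcongr; omega
        have hz : (state (.cons (merge (enc a)) rest)
            (.cons (enc (R d)) (.cons (enc (R b)) vals))).size ≤ N := by
          simp only [state, merge, Data.size_cons, Data.size_nil, esize] at *; omega
        have hm₁ : step.Within O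
            (state (.cons (merge (enc a)) rest) (.cons (enc (R d)) (.cons (enc (R b)) vals)))
            (state rest (.cons (enc (R a)) vals)) (20 * N + 5 * c s + 20) :=
          within_merge (e₅.mono (by simp only [c]; omega)) hz
        have k₁ := Prog.Within.loop_step Prog.Within.fst hm₁ hm
        have k₂ := ih d (by omega) hr (.cons (merge (enc a)) rest) (.cons (enc (R b)) vals) (by
          simp only [merge, Data.size_cons, Data.size_nil, esize] at *; omega) _ _ k₁
        have k₃ := ih b (by omega) hl (.cons (call (enc d)) (.cons (merge (enc a)) rest)) vals (by
          simp only [call, merge, Data.size_cons, Data.size_nil, esize] at *; omega) _ _ k₂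
        have hs₁ := within_split (base := P₂) (comb := P₅) (vals := vals) (rest := rest)
          (c := c s) (e₁.mono (by simp only [c]; omega)) (e₃.mono (by simp only [c]; omega))
          (e₄.mono (by simp only [c]; omega)) hsz
        refine (Prog.Within.loop_step Prog.Within.fst hs₁ k₃).mono ?_
        have hmul : (3 * (μ b + μ d) + 4) * (31 * N + 5 * c s + 41) ≤
            (3 * μ a + 1) * (31 * N + 5 * c s + 41) := Nat.mul_le_mul_right _ (by omega)
        have hsum : (3 * (μ b + μ d) + 4) * (31 * N + 5 * c s + 41) =
            (3 * μ d + 1) * (31 * N + 5 * c s + 41) + (3 * μ b + 1) * (31 * N + 5 * c s + 41) +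
              2 * (31 * N + 5 * c s + 41) := by ring
        omega
  -- start with the single task at the input, and read off the only value in the end
  let n : Polynomial ℕ := 2 + (q + 1) * (4 * q + 20)
  let cq : Polynomial ℕ := p₁.comp q + p₂.comp q + p₃.comp q + p₄.comp q + p₅.comp (3 * q + 2)
  refine ⟨.seq (.pair (.pair (.pair .nil .id) .nil) .nil) (.seq (.loop .fst step)
    (.seq .snd .fst)), 4 * .X + 3 + ((q + 5) + (3 * q + 1) * (31 * n + 5 * cq + 41)) +
      (3 * q + 20), fun a => ?_⟩
  have hq := hSq a
  have qa := (hSa a).trans hq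
  have qR := (hSR a).trans hq
  have qμ := (hSμ a).trans hq
  have start : (Prog.pair (.pair (.pair .nil .id) .nil) .nil).Within O (enc a)
      (state (.cons (call (enc a)) .nil) .nil) (4 * esize a + 3) := by
    refine (((Prog.Within.nil.pair .id).pair .nil).pair .nil).mono ?_
    simp only [esize]; omega
  have halt : (Prog.loop .fst step).Within O (state .nil (.cons (enc (R a)) .nil))
      (state .nil (.cons (enc (R a)) .nil)) (q.eval (esize a) + 5) := by
    refine Prog.Within.loop_stop (Prog.Within.fst) |>.mono ?_
    simp only [state, Data.size_cons, Data.size_nil, esize] at *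
    omega
  have run := main (q.eval (esize a)) (n.eval (esize a)) (μ a) a le_rfl hq .nil .nil (by
    simp only [n, Data.size_nil, Polynomial.eval_add, Polynomial.eval_mul, Polynomial.eval_one,
      Polynomial.eval_ofNat]
    gcongr
    norm_num) _ _ halt
  have out : (Prog.seq .snd .fst).Within O (state .nil (.cons (enc (R a)) .nil)) (enc (R a))
      (2 * q.eval (esize a) + 10) := by
    refine (Prog.Within.snd.seq Prog.Within.fst).mono ?_
    simp only [state, Data.size_cons, Data.size_nil, esize, Data.snd_cons] at *
    omega
  refine (start.seq (run.seq out)).mono ?_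
  have hmul : (3 * μ a + 1) * (31 * n.eval (esize a) + 5 * c (q.eval (esize a)) + 41) ≤
      (3 * q.eval (esize a) + 1) * (31 * n.eval (esize a) + 5 * c (q.eval (esize a)) + 41) := by
    gcongr
  have hcq : cq.eval (esize a) = c (q.eval (esize a)) := by
    simp [cq, c, Polynomial.eval_comp]
  simp only [Polynomial.eval_add, Polynomial.eval_mul, Polynomial.eval_one, Polynomial.eval_X,
    Polynomial.eval_ofNat, hcq]
  omega

/-! ### Equality tests and operations on lists -/

/-- Whether a tree has two subtrees. -/
def Data.isCons : Data → Bool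
  | nil => false
  | cons _ _ => true

@[simp] theorem Data.isCons_nil : nil.isCons = false := rfl

@[simp] theorem Data.isCons_cons (a b : Data) : (cons a b).isCons = true := rfl

theorem Data.isCons_eq_true {d : Data} : d.isCons = true ↔ ∃ a b, d = cons a b := by
  cases d <;> simp

open Classical in
/-- The truth value of a proposition. -/
noncomputable def holds (p : Prop) : Bool := decide p

@[simp] theorem holds_eq_true {p : Prop} : holds p = true ↔ p := by
  simp [holds]

@[simp] theorem holds_eq_false {p : Prop} : holds p = false ↔ ¬p := by
  simp [holds]

@[simp] theorem holds_true : holds True = true := by simp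

@[simp] theorem holds_false : holds False = false := by simp

/-- Equality as a Boolean test. -/
noncomputable def eqB {α : Type} (a b : α) : Bool := holds (a = b)

@[simp] theorem eqB_eq_true {α : Type} {a b : α} : eqB a b = true ↔ a = b := by
  simp [eqB]

@[simp] theorem eqB_eq_false {α : Type} {a b : α} : eqB a b = false ↔ a ≠ b := by
  simp [eqB]

/-- Membership in a list as a Boolean test. -/
noncomputable def memB {α : Type} (a : α) (l : List α) : Bool := l.any (eqB a)

@[simp] theorem memB_eq_true {α : Type} {a : α} {l : List α} : memB a l = true ↔ a ∈ l := by
  simp [memB]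

theorem mem_esize_lt {α : Type} [Enc α] {a : α} {l : List α} (h : a ∈ l) :
    esize a < esize l := by
  induction l with
  | nil => simp at h
  | cons b l ih =>
    have := esize_pos l
    rcases List.mem_cons.mp h with rfl | h
    · simp only [esize_cons]; omega
    · have := ih h
      simp only [esize_cons]; omega

theorem esize_flatten_le {α : Type} [Enc α] (l : List (List α)) :
    esize l.flatten ≤ esize l := by
  induction l with
  | nil => simp
  | cons a l ih =>
    have := esize_append a l.flatten
    simp only [List.flatten_cons, esize_cons]
    omega

namespace PolyFun

variable {O : Set Data} {α β γ δ ε : Type} [Enc α] [Enc β] [Enc γ] [Enc δ] [Enc ε]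

theorem dataIsCons : PolyFun O Data.isCons := by
  refine ⟨.ite .id (.pair .nil .nil) .nil, 3 * .X + 2, fun a => ?_⟩
  cases a with
  | nil =>
    refine (Prog.Within.ite_else .id .nil).mono ?_
    simp [esize]
  | cons a b =>
    refine (Prog.Within.ite_then .id (Prog.Within.nil.pair .nil)).mono ?_
    simp [esize]; omega

@[fun_prop]
theorem isCons {f : α → Data} (hf : PolyFun O f) : PolyFun O (fun a => (f a).isCons) :=
  dataIsCons.comp hf

@[fun_prop]
theorem isEmpty {l : α → List β} (hl : PolyFun O l) : PolyFun O (fun a => (l a).isEmpty) :=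
  of_enc (g := fun a => !(enc (l a)).isCons) (by fun_prop) fun a => by
    cases l a <;> simp

theorem dataEq : PolyFun O (fun p : Data × Data => eqB p.1 p.2) := by
  refine recursion (leaf := fun p => !(p.1.isCons && p.2.isCons))
    (base := fun p => !p.1.1.isCons && !p.1.2.isCons)
    (l := fun p => (p.1.1.fst, p.1.2.fst)) (r := fun p => (p.1.1.snd, p.1.2.snd))
    (comb := fun p => p.2.1 && p.2.2) (by fun_prop) (by fun_prop) (by fun_prop) (by fun_prop)
    (by fun_prop) _ ?_ ?_ (fun p => esize p.1) (fun p => esize p + 3) (.X + 3) ?_ ?_ ?_ ?_ ?_ ?_ ?_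
  · rintro ⟨⟨x, y⟩, h⟩
    dsimp only at h ⊢
    rw [Bool.eq_iff_iff]
    cases x <;> cases y <;> simp_all
  · rintro ⟨⟨x, y⟩, h⟩
    dsimp only at h ⊢
    rw [Bool.eq_iff_iff]
    cases x <;> cases y <;> simp_all
  · rintro ⟨⟨x, y⟩, h⟩
    dsimp only at h ⊢
    cases x <;> cases y <;> simp_all [esize]
  · rintro ⟨⟨x, y⟩, h⟩
    have := x.size_fst_le
    have := y.size_fst_le
    simp only [esize_pair, Nat.add_le_add_iff_right]
    exact Nat.add_le_add ‹_› ‹_›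
  · rintro ⟨⟨x, y⟩, h⟩
    have := x.size_snd_le
    have := y.size_snd_le
    simp only [esize_pair, Nat.add_le_add_iff_right]
    exact Nat.add_le_add ‹_› ‹_›
  · intro p; omega
  · intro p; exact (esize_bool_le _).trans (by omega)
  · rintro ⟨x, y⟩; simp only [esize_pair]; omega
  · intro p; simp

@[fun_prop]
theorem eqB {f g : α → β} (hf : PolyFun O f) (hg : PolyFun O g) :
    PolyFun O (fun a => eqB (f a) (g a)) :=
  of_enc (g := fun a => DRSL.eqB (enc (f a)) (enc (g a)))
    (dataEq.comp ((enc_fun.comp hf).prodMk (enc_fun.comp hg))) fun a => by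
      congr 1
      rw [Bool.eq_iff_iff]
      simp [enc_injective.eq_iff]

@[fun_prop]
theorem listCons {f : α → β} {l : α → List β} (hf : PolyFun O f) (hl : PolyFun O l) :
    PolyFun O (fun a => f a :: l a) :=
  of_enc (hf.prodMk hl) fun _ => rfl

/-- Folding over the second component of a pair, with the first one as a parameter. -/
theorem foldr' {f : ε → β → γ → γ} {i : ε → γ}
    (hf : PolyFun O fun p : ε × β × γ => f p.1 p.2.1 p.2.2) (hi : PolyFun O i) (q : Polynomial ℕ)
    (hq : ∀ e (l : List β), esize (l.foldr (f e) (i e)) ≤ q.eval (esize (e, l))) :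
    PolyFun O fun p : ε × List β => p.2.foldr (f p.1) (i p.1) := by
  have hne : ∀ p : {p : ε × List β // p.2.isEmpty = false}, p.1.2 ≠ [] := by
    rintro ⟨⟨e, l⟩, h⟩
    simpa using h
  have hsplit : PolyFun O (fun p : {p : ε × List β // p.2.isEmpty = false} =>
      (p.1.1, p.1.2.head (hne p), p.1.2.tail)) := retype fun p => by
    obtain ⟨⟨e, l⟩, h⟩ := p
    cases l with
    | nil => simp at h
    | cons b l => rfl
  refine recursion (leaf := fun p => p.2.isEmpty) (base := fun p => i p.1.1)
    (l := fun p => (p.1.1, p.1.2.tail)) (r := fun p => (p.1.1, []))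
    (comb := fun p => f p.1.1.1 (p.1.1.2.head (hne p.1)) p.2.1)
    (by fun_prop) (by fun_prop)
    ((show PolyFun O fun q : ε × β × List β => (q.1, q.2.2) by fun_prop).comp hsplit)
    (by fun_prop)
    ((hf.comp (g := fun q : (ε × β × List β) × γ × γ => (q.1.1, q.1.2.1, q.2.1))
      (by fun_prop)).comp ((hsplit.comp fst).prodMk snd))
    _ ?_ ?_ (fun p => p.2.length) (fun p => (q + .X).eval (esize p)) (q + .X) ?_ ?_ ?_ ?_ ?_ ?_ ?_
  · rintro ⟨⟨e, l⟩, h⟩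
    cases l with
    | nil => rfl
    | cons b l => simp at h
  · rintro ⟨⟨e, l⟩, h⟩
    cases l with
    | nil => simp at h
    | cons b l => rfl
  · rintro ⟨⟨e, l⟩, h⟩
    dsimp only at h ⊢
    cases l <;> simp_all
  · rintro ⟨⟨e, l⟩, h⟩
    refine eval_mono _ ?_
    have := esize_sublist l.tail_sublist
    simp only [esize_pair]; omega
  · rintro ⟨⟨e, l⟩, h⟩
    refine eval_mono _ ?_
    have := esize_pos l
    simp only [esize_pair, esize_nil]; omega
  · rintro ⟨e, l⟩; simp
  · rintro ⟨e, l⟩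
    simpa using Nat.le_add_right_of_le (hq e l)
  · rintro ⟨e, l⟩
    have := length_le_esize l
    simp only [Polynomial.eval_add, Polynomial.eval_X, esize_pair]; omega
  · intro p; exact le_rfl

/-- Folding over a list, provided that the results remain of polynomial size. -/
theorem foldr {f : α → β → γ → γ} {i : α → γ} {l : α → List β}
    (hf : PolyFun O fun p : α × β × γ => f p.1 p.2.1 p.2.2) (hi : PolyFun O i)
    (hl : PolyFun O l) (q : Polynomial ℕ)
    (hq : ∀ e (l : List β), esize (l.foldr (f e) (i e)) ≤ q.eval (esize (e, l))) :
    PolyFun O fun a => (l a).foldr (f a) (i a) :=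
  (foldr' hf hi q hq).comp (id.prodMk hl)

@[fun_prop]
theorem map {f : α → β → γ} {l : α → List β} (hl : PolyFun O l)
    (hf : PolyFun O fun p : α × β => f p.1 p.2) : PolyFun O fun a => (l a).map (f a) := by
  obtain ⟨p, hp⟩ := hf.esize_le
  refine of_enc (foldr (f := fun a b r => f a b :: r) (i := fun _ => [])
    ((hf.comp (g := fun p : α × β × List γ => (p.1, p.2.1)) (by fun_prop)).listCons
      (by fun_prop)) (by fun_prop) hl (.X * (p + 1) + 1) ?_) fun a => ?_
  · intro a l
    rw [show l.foldr (fun b r => f a b :: r) [] = l.map (f a) by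
      induction l <;> simp_all]
    refine (esize_le_of_forall_le (n := p.eval (esize (a, l))) ?_).trans ?_
    · intro c hc
      obtain ⟨b, hb, rfl⟩ := List.mem_map.mp hc
      refine (hp (a, b)).trans (eval_mono p ?_)
      have := mem_esize_lt hb
      simp only [esize_pair]; omega
    · have := length_le_esize l
      simp only [List.length_map, Polynomial.eval_add, Polynomial.eval_mul, Polynomial.eval_X,
        Polynomial.eval_one, esize_pair]
      gcongr
      omega
  · congr 1
    induction l a <;> simp_all

@[fun_prop]
theorem filter {f : α → β → Bool} {l : α → List β} (hl : PolyFun O l)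
    (hf : PolyFun O fun p : α × β => f p.1 p.2) : PolyFun O fun a => (l a).filter (f a) := by
  have key : ∀ (a : α) (l : List β),
      l.foldr (fun b r => bif f a b then b :: r else r) [] = l.filter (f a) := by
    intro a l
    induction l with
    | nil => rfl
    | cons b l ih =>
      rw [List.foldr_cons, ih, List.filter_cons]
      cases f a b <;> rfl
  refine of_enc (foldr (f := fun a b r => bif f a b then b :: r else r) (i := fun _ => [])
    ((hf.comp (g := fun p : α × β × List β => (p.1, p.2.1)) (by fun_prop)).cond
      (by fun_prop) (by fun_prop)) (by fun_prop) hl .X ?_) fun a => by rw [key]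
  intro a l
  rw [key, Polynomial.eval_X, esize_pair]
  have := esize_sublist (List.filter_sublist (p := f a) (l := l))
  omega

@[fun_prop]
theorem any {f : α → β → Bool} {l : α → List β} (hl : PolyFun O l)
    (hf : PolyFun O fun p : α × β => f p.1 p.2) : PolyFun O fun a => (l a).any (f a) := by
  refine of_enc (foldr (f := fun a b r => f a b || r) (i := fun _ => false)
    ((hf.comp (g := fun p : α × β × Bool => (p.1, p.2.1)) (by fun_prop)).bor
      (by fun_prop)) (by fun_prop) hl 3 fun _ _ => ?_) fun a => ?_
  · simpa using esize_bool_le _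
  · congr 1
    induction l a <;> simp_all

@[fun_prop]
theorem all {f : α → β → Bool} {l : α → List β} (hl : PolyFun O l)
    (hf : PolyFun O fun p : α × β => f p.1 p.2) : PolyFun O fun a => (l a).all (f a) := by
  refine of_enc (foldr (f := fun a b r => f a b && r) (i := fun _ => true)
    ((hf.comp (g := fun p : α × β × Bool => (p.1, p.2.1)) (by fun_prop)).band
      (by fun_prop)) (by fun_prop) hl 3 fun _ _ => ?_) fun a => ?_
  · simpa using esize_bool_le _
  · congr 1
    induction l a <;> simp_all

@[fun_prop]
theorem memB {f : α → β} {l : α → List β} (hf : PolyFun O f) (hl : PolyFun O l) :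
    PolyFun O fun a => memB (f a) (l a) := by
  unfold DRSL.memB
  fun_prop

@[fun_prop]
theorem append {l m : α → List β} (hl : PolyFun O l) (hm : PolyFun O m) :
    PolyFun O fun a => l a ++ m a := by
  have key := (foldr' (O := O) (f := fun (_ : List β) (b : β) r => b :: r) (i := fun m => m)
    (by fun_prop) (by fun_prop) .X ?_).comp (hm.prodMk hl)
  · exact of_enc key fun a => by simp
  · intro m l
    have := esize_append l m
    simp only [Polynomial.eval_X, esize_pair]
    simp
    omega

@[fun_prop]
theorem flatten {l : α → List (List β)} (hl : PolyFun O l) :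
    PolyFun O fun a => (l a).flatten := by
  have key : ∀ l : List (List β), l.foldr (fun b r => b ++ r) [] = l.flatten := by
    intro l
    induction l <;> simp_all
  refine of_enc (foldr (f := fun (_ : α) (b : List β) r => b ++ r) (i := fun _ => [])
    (by fun_prop) (by fun_prop) hl .X ?_) fun a => by rw [key]
  intro a l
  rw [key, Polynomial.eval_X, esize_pair]
  exact (esize_flatten_le l).trans (by omega)

@[fun_prop]
theorem flatMap {f : α → β → List γ} {l : α → List β} (hl : PolyFun O l)
    (hf : PolyFun O fun p : α × β => f p.1 p.2) : PolyFun O fun a => (l a).flatMap (f a) := by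
  have : PolyFun O fun a => ((l a).map (f a)).flatten := by fun_prop
  exact of_enc this fun a => by rw [List.flatMap_def]

/-- Iterating a function as many times as a list is long, provided that all iterates are of
polynomial size. -/
theorem iterate {f : α → γ → γ} {i : α → γ} {l : α → List β}
    (hf : PolyFun O fun p : α × γ => f p.1 p.2) (hi : PolyFun O i) (hl : PolyFun O l)
    (q : Polynomial ℕ) (hq : ∀ a k, esize ((f a)^[k] (i a)) ≤ q.eval (esize a)) :
    PolyFun O fun a => (f a)^[(l a).length] (i a) := by
  have key : ∀ (a : α) (l : List β), l.foldr (fun _ r => f a r) (i a) = (f a)^[l.length] (i a) := by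
    intro a l
    induction l with
    | nil => rfl
    | cons b l ih => rw [List.foldr_cons, ih, List.length_cons, Function.iterate_succ_apply']
  refine of_enc (foldr (f := fun a _ r => f a r) (hf.comp (g := fun p : α × β × γ => (p.1, p.2.2))
    (by fun_prop)) hi hl q ?_) fun a => by rw [key]
  intro a l
  rw [key]
  exact (hq a _).trans (eval_mono q (by simp only [esize_pair]; omega))

end PolyFun

/-! ### Encoded formulas -/

theorem Fml.enc_injective : Function.Injective Fml.enc := by
  intro a
  induction a with
  | atom p =>
    intro b h
    cases b <;> simp [Fml.enc, Data.tag] at h ⊢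
    exact DRSL.Enc.enc_injective (α := Name) h
  | bot => intro b h; cases b <;> simp [Fml.enc, Data.tag] at h ⊢
  | top => intro b h; cases b <;> simp [Fml.enc, Data.tag] at h ⊢
  | neg a ih =>
    intro b h
    cases b <;> simp [Fml.enc, Data.tag] at h ⊢
    exact ih h
  | _ a b iha ihb =>
    intro c h
    cases c <;> simp [Fml.enc, Data.tag] at h ⊢
    exact ⟨iha h.1, ihb h.2⟩

instance : Enc Fml := ⟨Fml.enc, Fml.enc_injective⟩

instance : Enc Cond where
  enc c := enc (c.ante, c.conc)
  enc_injective := by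
    rintro ⟨a, b⟩ ⟨c, d⟩ h
    have := enc_injective h
    simp_all

theorem KLM.enc_injective : Function.Injective KLM.enc := by
  intro a
  induction a with
  | bool a =>
    intro b h
    cases b <;> simp [KLM.enc, Data.tag] at h ⊢
    exact Fml.enc_injective h
  | cond c =>
    intro b h
    rcases c with ⟨c, d⟩
    cases b with
    | cond c' =>
      rcases c' with ⟨c', d'⟩
      simp [KLM.enc] at h ⊢
      exact ⟨Fml.enc_injective h.1, Fml.enc_injective h.2⟩
    | _ => simp [KLM.enc, Data.tag] at h
  | and a b iha ihb =>
    intro c h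
    cases c <;> simp [KLM.enc, Data.tag] at h ⊢
    exact ⟨iha h.1, ihb h.2⟩

instance : Enc KLM := ⟨KLM.enc, KLM.enc_injective⟩

theorem Standpoint.enc_injective : Function.Injective Standpoint.enc := by
  intro a b h
  cases a <;> cases b <;> simp [Standpoint.enc] at h ⊢
  exact DRSL.Enc.enc_injective (α := Name) h

instance : Enc Standpoint := ⟨Standpoint.enc, Standpoint.enc_injective⟩

theorem Item.enc_injective : Function.Injective Item.enc := by
  intro a b h
  cases a <;> cases b <;> simp [Item.enc, Data.tag] at h ⊢
  · exact ⟨Standpoint.enc_injective h.1, KLM.enc_injective h.2⟩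
  · exact ⟨Standpoint.enc_injective h.1, KLM.enc_injective h.2⟩
  · exact ⟨Standpoint.enc_injective h.1, Standpoint.enc_injective h.2⟩

instance : Enc Item := ⟨Item.enc, Item.enc_injective⟩

theorem Query.enc_injective : Function.Injective Query.enc := by
  intro a
  induction a with
  | and a b iha ihb =>
    intro c h
    cases c <;> simp [Query.enc, Data.tag] at h ⊢
    exact ⟨iha h.1, ihb h.2⟩
  | _ s φ =>
    intro b h
    cases b <;> simp [Query.enc, Data.tag] at h ⊢
    exact ⟨Standpoint.enc_injective h.1, KLM.enc_injective h.2⟩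

instance : Enc Query := ⟨Query.enc, Query.enc_injective⟩

section

variable (a b : Fml) (p : Name)

@[simp] theorem enc_atom : enc (Fml.atom p) = .cons (.tag 0) (enc p) := rfl
@[simp] theorem enc_bot : enc Fml.bot = .cons (.tag 1) .nil := rfl
@[simp] theorem enc_top : enc Fml.top = .cons (.tag 2) .nil := rfl
@[simp] theorem enc_neg : enc (Fml.neg a) = .cons (.tag 3) (enc a) := rfl
@[simp] theorem enc_and : enc (Fml.and a b) = .cons (.tag 4) (.cons (enc a) (enc b)) := rfl
@[simp] theorem enc_or : enc (Fml.or a b) = .cons (.tag 5) (.cons (enc a) (enc b)) := rfl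
@[simp] theorem enc_imp : enc (Fml.imp a b) = .cons (.tag 6) (.cons (enc a) (enc b)) := rfl
@[simp] theorem enc_iff : enc (Fml.iff a b) = .cons (.tag 7) (.cons (enc a) (enc b)) := rfl

end

@[simp] theorem Data.tag_inj {m n : ℕ} : Data.tag m = Data.tag n ↔ m = n := by
  induction m generalizing n with
  | zero => cases n <;> simp [Data.tag]
  | succ m ih => cases n <;> simp [Data.tag, ih]

theorem Data.size_tag (n : ℕ) : (Data.tag n).size = 2 * n + 1 := by
  induction n with
  | zero => rfl
  | succ n ih => simp [Data.tag, ih]; omega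

/-- The name of an atom (empty for other formulas). -/
def Fml.name : Fml → Name
  | atom p => p
  | _ => []

/-- The first immediate subformula (the formula itself if there is none). -/
def Fml.left : Fml → Fml
  | neg a | and a _ | or a _ | imp a _ | iff a _ => a
  | a => a

/-- The second immediate subformula (`⊥` if there is none). -/
def Fml.right : Fml → Fml
  | and _ b | or _ b | imp _ b | iff _ b => b
  | _ => bot

/-- Whether the formula is an atom or a truth constant. -/
def Fml.isLeaf : Fml → Bool
  | atom _ | bot | top => true
  | _ => false

namespace PolyFun

variable {O : Set Data} {α β γ δ ε : Type} [Enc α] [Enc β] [Enc γ] [Enc δ] [Enc ε]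

/-- The tags of atoms and truth constants are `0`, `1`, `2`, so that their second right subtree is a
leaf; those of compound formulas are larger. -/
theorem fmlIsLeaf : PolyFun O Fml.isLeaf :=
  of_enc (g := fun a : Fml => !(enc a).fst.snd.snd.isCons) (by fun_prop) fun a => by
    cases a <;> rfl

theorem fmlName : PolyFun O Fml.name :=
  of_data (g := fun d : Data => bif DRSL.eqB d.fst (.tag 0) then d.snd else .nil) (by fun_prop)
    fun a => by cases a <;> simp [Fml.name, DRSL.eqB]

theorem fmlLeft : PolyFun O Fml.left :=
  of_data (g := fun d : Data => bif DRSL.eqB d.fst (.tag 3) then d.snd else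
    bif d.fst.snd.snd.isCons then d.snd.fst else d) (by fun_prop)
    fun a => by cases a <;> simp [Fml.left, DRSL.eqB] <;> rfl

theorem fmlRight : PolyFun O Fml.right :=
  of_data (g := fun d : Data => bif d.fst.snd.snd.snd.isCons then d.snd.snd else enc Fml.bot)
    (by fun_prop) fun a => by cases a <;> rfl

/-- Structural recursion on Boolean formulas with a parameter, provided that the results are of
polynomial size. -/
theorem fmlRec {fa : ε → Name → β} {fb ft : ε → β} {fn : ε → β → β} {f₁ f₂ f₃ f₄ : ε → β → β → β}
    (hfa : PolyFun O fun p : ε × Name => fa p.1 p.2) (hfb : PolyFun O fb) (hft : PolyFun O ft)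
    (hfn : PolyFun O fun p : ε × β => fn p.1 p.2)
    (h₁ : PolyFun O fun p : ε × β × β => f₁ p.1 p.2.1 p.2.2)
    (h₂ : PolyFun O fun p : ε × β × β => f₂ p.1 p.2.1 p.2.2)
    (h₃ : PolyFun O fun p : ε × β × β => f₃ p.1 p.2.1 p.2.2)
    (h₄ : PolyFun O fun p : ε × β × β => f₄ p.1 p.2.1 p.2.2)
    (R : ε → Fml → β) (ratom : ∀ e p, R e (.atom p) = fa e p) (rbot : ∀ e, R e .bot = fb e)
    (rtop : ∀ e, R e .top = ft e) (rneg : ∀ e a, R e (.neg a) = fn e (R e a))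
    (rand : ∀ e a b, R e (.and a b) = f₁ e (R e a) (R e b))
    (ror : ∀ e a b, R e (.or a b) = f₂ e (R e a) (R e b))
    (rimp : ∀ e a b, R e (.imp a b) = f₃ e (R e a) (R e b))
    (riff : ∀ e a b, R e (.iff a b) = f₄ e (R e a) (R e b))
    (q : Polynomial ℕ) (hq : ∀ e a, esize (R e a) ≤ q.eval (esize (e, a))) :
    PolyFun O fun p : ε × Fml => R p.1 p.2 := by
  have hbase : PolyFun O (fun p : {p : ε × Fml // p.2.isLeaf = true} =>
      bif DRSL.eqB (enc p.1.2).fst (.tag 0) then fa p.1.1 p.1.2.name else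
      bif DRSL.eqB (enc p.1.2).fst (.tag 1) then fb p.1.1 else ft p.1.1) := by
    have := hfa.comp (g := fun p : {p : ε × Fml // p.2.isLeaf = true} => (p.1.1, p.1.2.name))
      (prodMk (by fun_prop) (fmlName.comp (by fun_prop)))
    exact cond (by fun_prop) this (by fun_prop)
  -- the tags of `¬`, `∧`, `∨`, `→`, `↔` are `3`, …, `7`
  have hcomb : PolyFun O (fun p : {p : ε × Fml // p.2.isLeaf = false} × β × β =>
      bif DRSL.eqB (enc p.1.1.2).fst (.tag 3) then fn p.1.1.1 p.2.1 else
      bif DRSL.eqB (enc p.1.1.2).fst (.tag 4) then f₁ p.1.1.1 p.2.1 p.2.2 else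
      bif DRSL.eqB (enc p.1.1.2).fst (.tag 5) then f₂ p.1.1.1 p.2.1 p.2.2 else
      bif DRSL.eqB (enc p.1.1.2).fst (.tag 6) then f₃ p.1.1.1 p.2.1 p.2.2 else
      f₄ p.1.1.1 p.2.1 p.2.2) := by
    have h₀ : PolyFun O (fun p : {p : ε × Fml // p.2.isLeaf = false} × β × β =>
      (p.1.1.1, p.2.1)) := by fun_prop
    have h : PolyFun O (fun p : {p : ε × Fml // p.2.isLeaf = false} × β × β =>
      (p.1.1.1, p.2.1, p.2.2)) := by fun_prop
    exact cond (by fun_prop) (hfn.comp h₀) (cond (by fun_prop) (h₁.comp h)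
      (cond (by fun_prop) (h₂.comp h) (cond (by fun_prop) (h₃.comp h) (h₄.comp h))))
  have hl : PolyFun O (fun p : {p : ε × Fml // Fml.isLeaf p.2 = false} => (p.1.1, p.1.2.left)) :=
    prodMk (by fun_prop) (fmlLeft.comp (by fun_prop))
  have hr : PolyFun O (fun p : {p : ε × Fml // Fml.isLeaf p.2 = false} => (p.1.1, p.1.2.right)) :=
    prodMk (by fun_prop) (fmlRight.comp (by fun_prop))
  refine recursion (leaf := fun p : ε × Fml => p.2.isLeaf) (fmlIsLeaf.comp snd) hbase hl hr hcomb
    (fun p => R p.1 p.2) ?_ ?_ (fun p => esize p.2) (fun p => (q + .X + 5).eval (esize p))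
    (q + .X + 5) ?_ ?_ ?_ ?_ ?_ ?_ ?_
  · rintro ⟨⟨e, a⟩, h⟩
    cases a <;> first
      | exact absurd h Bool.false_ne_true
      | simp [ratom, rbot, rtop, Fml.name, DRSL.eqB]
  · rintro ⟨⟨e, a⟩, h⟩
    cases a <;> first
      | exact absurd h.symm Bool.false_ne_true
      | simp [rneg, rand, ror, rimp, riff, Fml.left, Fml.right, DRSL.eqB]
  · rintro ⟨⟨e, a⟩, h⟩
    cases a <;> first
      | exact absurd h.symm Bool.false_ne_true
      | (simp [Fml.left, Fml.right, esize, Data.size_tag]; omega)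
  · rintro ⟨⟨e, a⟩, h⟩
    refine eval_mono _ ?_
    cases a <;> first
      | exact absurd h.symm Bool.false_ne_true
      | (simp [Fml.left, esize, Data.size_tag]; omega)
  · rintro ⟨⟨e, a⟩, h⟩
    refine eval_mono _ ?_
    cases a <;> first
      | exact absurd h.symm Bool.false_ne_true
      | (simp [Fml.right, esize, Data.size_tag]; omega)
  · rintro ⟨e, a⟩
    simp only [Polynomial.eval_add, Polynomial.eval_X]; omega
  · rintro ⟨e, a⟩
    have := hq e a
    simp only [Polynomial.eval_add, Polynomial.eval_X]; omega
  · rintro ⟨e, a⟩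
    simp only [Polynomial.eval_add, Polynomial.eval_X, esize_pair]; omega
  · intro p; exact le_rfl

end PolyFun

/-! ### Saturation -/

/-- The set of those members of `U` that are derived in rounds from the empty set, where a set `X`
derives the members `u` of `U` with `T X u`. Derived members are kept, so that `T` need not be
monotone. -/
noncomputable def sat {σ : Type} (U : List σ) (T : List σ → σ → Bool) : List σ :=
  (fun X => U.filter fun u => memB u X || T X u)^[U.length] []

section sat

variable {σ : Type} {U : List σ} {T : List σ → σ → Bool}

theorem iterate_sat_sublist (k : ℕ) :
    ((fun X => U.filter fun u => memB u X || T X u)^[k] []).Sublist U := by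
  cases k with
  | zero => exact List.nil_sublist U
  | succ k =>
    rw [Function.iterate_succ_apply']
    exact List.filter_sublist

/-- The rounds grow until they are stable, which they are after at most `|U|` rounds. -/
theorem sat_closed {u : σ} (hu : u ∈ U) (h : T (sat U T) u = true) : u ∈ sat U T := by
  set step : List σ → List σ := fun X => U.filter fun u => memB u X || T X u with hstep
  have hsub : ∀ k, (step^[k] []).Sublist (step^[k + 1] []) := by
    intro k
    cases k with
    | zero => exact List.nil_sublist _
    | succ k =>
      rw [Function.iterate_succ_apply' step (k + 1)]
      have : step^[k + 1] [] = (step (step^[k + 1] [])).filter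
          fun u => memB u (step^[k] []) || T (step^[k] []) u := by
        rw [List.filter_filter, Function.iterate_succ_apply' step k]
        refine List.filter_congr fun u hu => ?_
        cases h : memB u (step^[k] []) || T (step^[k] []) u with
        | false => rfl
        | true =>
          have : memB u (step (step^[k] [])) = true :=
            memB_eq_true.mpr (List.mem_filter.mpr ⟨hu, h⟩)
          rw [this]
          rfl
      nth_rewrite 1 [this]
      exact List.filter_sublist
  have hfix : step (step^[U.length] []) = step^[U.length] [] := by
    have := Nat.stabilises_of_monotone (f := fun k => (step^[k] []).length) (b := U.length)
      (n := U.length + 1) (monotone_nat_of_le_succ fun k => (hsub k).length_le)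
      (fun k => (iterate_sat_sublist k).length_le)
      (fun m hm => by
        have e := (hsub m).eq_of_length hm
        simp only [Function.iterate_succ_apply' step] at e ⊢
        rw [← e, ← e]) (Nat.le_succ _)
    have e := (hsub U.length).eq_of_length this.symm
    rw [Function.iterate_succ_apply'] at e
    exact e.symm
  change u ∈ step^[U.length] []
  rw [← hfix]
  exact List.mem_filter.mpr ⟨hu, by
    rw [Bool.or_eq_true]
    exact Or.inr h⟩

theorem sat_induction {P : σ → Prop}
    (h : ∀ X : List σ, (∀ x ∈ X, P x) → ∀ u ∈ U, T X u = true → P u) : ∀ u ∈ sat U T, P u := by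
  unfold sat
  generalize U.length = k
  induction k with
  | zero => simp
  | succ k ih =>
    intro u hu
    rw [Function.iterate_succ_apply', List.mem_filter, Bool.or_eq_true, memB_eq_true] at hu
    rcases hu with ⟨hU, hX | hT⟩
    · exact ih u hX
    · exact h _ ih u hU hT

end sat

/-! ### The algorithms -/

/-- The atoms with a positive (or, for `false`, negative) occurrence, listed. -/
def Fml.posL : Bool → Fml → List Name
  | true, atom p => [p]
  | false, atom _ => []
  | _, bot => []
  | _, top => []
  | b, neg a => a.posL (!b)
  | b, and a c => a.posL b ++ c.posL b
  | b, or a c => a.posL b ++ c.posL b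
  | b, imp a c => a.posL (!b) ++ c.posL b
  | _, iff _ _ => []

theorem Fml.mem_posL {b : Bool} {a : Fml} {p : Name} : p ∈ a.posL b ↔ p ∈ a.posAtoms b := by
  induction a generalizing b with
  | atom q => cases b <;> simp [posL, posAtoms]
  | _ => cases b <;> simp_all [posL, posAtoms]

/-- The truth value of a formula under the valuation that makes the members of `M` true. -/
noncomputable def Fml.evalIn (M : List Name) (a : Fml) : Bool := a.eval fun p => memB p M

/-- `Fml.IsHorn` as a Boolean test. -/
noncomputable def Fml.hornB (a : Fml) : Bool := holds a.IsHorn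

/-- The defeasible implications of a KLM formula, listed. -/
def KLM.condL : KLM → List Cond
  | bool a => [⟨Fml.neg a, Fml.bot⟩]
  | cond c => [c]
  | and φ χ => φ.condL ++ χ.condL

theorem KLM.mem_condL {φ : KLM} {c : Cond} : c ∈ φ.condL ↔ c ∈ φ.conds := by
  induction φ <;> simp_all [condL, conds]

/-- The conjuncts of a query, listed: `(true, s, φ)` stands for `□_s φ`, and `(false, s, φ)` for
`◇_s φ`. -/
def Query.lits : Query → List (Bool × Standpoint × KLM)
  | box s φ => [(true, s, φ)]
  | dia s φ => [(false, s, φ)]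
  | and ψ χ => ψ.lits ++ χ.lits

/-- The first standpoint of a member of a knowledge base. -/
def Item.sp : Item → Standpoint
  | box s _ | dia s _ | sharp s _ => s

/-- The second standpoint of a sharpening statement. -/
def Item.target : Item → Standpoint
  | sharp _ t => t
  | _ => Standpoint.univ

/-- The KLM formula in a member of a knowledge base. -/
def Item.klm : Item → KLM
  | box _ φ | dia _ φ => φ
  | sharp _ _ => KLM.bool Fml.bot

/-- Whether the item is a formula `□_s φ`. -/
def Item.isBox : Item → Bool
  | box _ _ => true
  | _ => false

/-- Whether the item is a formula `◇_s φ`. -/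
def Item.isDia : Item → Bool
  | dia _ _ => true
  | _ => false

/-- Whether the item is a sharpening statement. -/
def Item.isSharp : Item → Bool
  | sharp _ _ => true
  | _ => false

section algorithms

variable (ent : List Cond × Fml → Bool)

/-- One step on the way to the set that decides a query with antecedent `a`: as long as `a` is
refuted, pass to the exceptional implications. Here `ent` stands for a test of entailment. -/
def rcStep (a : Fml) (F : List Cond) : List Cond :=
  bif ent (F, Fml.neg a) then F.filter fun c => ent (F, Fml.neg c.ante) else F

/-- `RCPropCond`, relative to a test of entailment. -/
def rcCondB (E : List Cond) (c : Cond) : Bool := ent ((rcStep ent c.ante)^[E.length] E, c.mat)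

/-- `RCProp`, relative to a test of entailment. -/
def rcPropB (B : List KLM) (φ : KLM) : Bool :=
  φ.condL.all fun c => rcCondB ent (B.flatMap KLM.condL) c

/-- The standpoints of a knowledge base, listed. -/
def standpointL (K : List Item) : List Standpoint :=
  K.flatMap fun i => bif i.isSharp then [i.sp, i.target] else [i.sp]

/-- The standpoints that are reached from `s` by a nonempty chain of sharpening statements. -/
noncomputable def reachL (K : List Item) (s : Standpoint) : List Standpoint :=
  sat (standpointL K) fun X u =>
    K.any fun i => i.isSharp && eqB i.target u && (eqB i.sp s || memB i.sp X)

/-- `SharpPlus` as a Boolean test. -/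
noncomputable def sharpB (K : List Item) (s t : Standpoint) : Bool :=
  eqB t s || eqB t Standpoint.univ || memB t (reachL K s)

/-- `boxBase`, listed. -/
noncomputable def boxL (K : List Item) (s : Standpoint) : List KLM :=
  (K.filter fun i => i.isBox && sharpB K s i.sp).map Item.klm

/-- `know`, listed. -/
noncomputable def knowL (K : List Item) (s : Standpoint) : List (List KLM) :=
  (standpointL K).flatMap fun t => bif sharpB K t s then
      (bif eqB s Standpoint.univ && eqB t Standpoint.univ then [] else [boxL K t]) ++
        (K.filter fun i => i.isDia && eqB i.sp t).map fun i => i.klm :: boxL K t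
    else []

/-- `RCStandpoint` for a conjunct of a query, relative to a test of entailment. -/
noncomputable def rcLitB (K : List Item) (l : Bool × Standpoint × KLM) : Bool :=
  bif l.1 then (knowL K l.2.1).all fun B => rcPropB ent B l.2.2
    else (knowL K l.2.1).any fun B => rcPropB ent B l.2.2

/-- `RCStandpoint`, relative to a test of entailment. -/
noncomputable def rcStandpointB (K : List Item) (ψ : Query) : Bool := ψ.lits.all (rcLitB ent K)

/-- `ClosedWorld` as a Boolean test. -/
noncomputable def closedWorldB (K : List Item) (ψ : Query) : Bool :=
  ψ.lits.all fun l => eqB l.2.1 Standpoint.univ || memB l.2.1 (standpointL K)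

/-- The Horn condition on an instance as a Boolean test. -/
noncomputable def hornInstanceB (K : List Item) (ψ : Query) : Bool :=
  (K.all fun i => i.isSharp || i.klm.condL.all fun c => c.mat.hornB) &&
    ψ.lits.all fun l => l.2.2.condL.all fun c => c.mat.hornB

end algorithms

/-! ### The algorithms run in polynomial time -/

namespace PolyFun

variable {O : Set Data} {α β γ δ ε σ : Type} [Enc α] [Enc β] [Enc γ] [Enc δ] [Enc ε] [Enc σ]

@[fun_prop]
theorem sat {U : α → List σ} {T : α → List σ → σ → Bool} (hU : PolyFun O U)
    (hT : PolyFun O fun p : α × List σ × σ => T p.1 p.2.1 p.2.2) :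
    PolyFun O fun a => sat (U a) (T a) := by
  obtain ⟨q, hq⟩ := hU.esize_le
  refine iterate (f := fun a X => (U a).filter fun u => DRSL.memB u X || T a X u)
    (i := fun _ => []) (l := U) ?_ (by fun_prop) hU q fun a k => ?_
  · have := hT.comp (g := fun p : (α × List σ) × σ => (p.1.1, p.1.2, p.2)) (by fun_prop)
    fun_prop
  · exact (esize_sublist (iterate_sat_sublist k)).trans (hq a)

/-- Collecting lists from the leaves of a binary tree. As the encodings of the parts of a tree are
disjoint, the collected list is of polynomial size if the lists at the leaves are. -/
theorem gather {leaf : α → Bool} {base : {a // leaf a = true} → List β}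
    {l r : {a // leaf a = false} → α} (hleaf : PolyFun O leaf) (hbase : PolyFun O base)
    (hl : PolyFun O l) (hr : PolyFun O r) (F : α → List β) (hF₁ : ∀ a, F a.1 = base a)
    (hF₂ : ∀ a, F a.1 = F (l a) ++ F (r a))
    (hsize : ∀ a, esize (l a) + esize (r a) < esize a.1) : PolyFun O F := by
  obtain ⟨p, hp⟩ := hbase.esize_le
  have hF : ∀ n a, esize a ≤ n → esize (F a) ≤ esize a * p.eval n := by
    intro n a
    induction h : esize a using Nat.strong_induction_on generalizing a with
    | _ m ih =>
    subst h
    intro hn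
    cases h : leaf a with
    | true =>
      rw [hF₁ ⟨a, h⟩]
      exact ((hp ⟨a, h⟩).trans (eval_mono p hn)).trans (Nat.le_mul_of_pos_left _ (esize_pos a))
    | false =>
      have hs := hsize ⟨a, h⟩
      have h₁ := ih _ (by simp only at hs; omega) (l ⟨a, h⟩) rfl (by simp only at hs; omega)
      have h₂ := ih _ (by simp only at hs; omega) (r ⟨a, h⟩) rfl (by simp only at hs; omega)
      have h₃ := esize_append (F (l ⟨a, h⟩)) (F (r ⟨a, h⟩))
      rw [hF₂ ⟨a, h⟩]
      have h₄ := Nat.mul_le_mul_right (p.eval n) hs.le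
      rw [add_mul] at h₄
      simp only at h₄
      omega
  refine recursion (comb := fun p => p.2.1 ++ p.2.2) hleaf hbase hl hr (by fun_prop) F hF₁ hF₂
    esize (fun a => (Polynomial.X * (p + 1)).eval (esize a)) (.X * (p + 1)) hsize ?_ ?_ ?_ ?_ ?_
    fun _ => le_rfl
  · exact fun a => eval_mono _ ((Nat.le_add_right _ _).trans (hsize a).le)
  · exact fun a => eval_mono _ ((Nat.le_add_left _ _).trans (hsize a).le)
  · intro a
    simp [mul_add]
  · intro a
    refine (hF _ a le_rfl).trans ?_
    simp [mul_add]
  · intro a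
    simp [mul_add]

@[fun_prop]
theorem neg {f : α → Fml} (hf : PolyFun O f) : PolyFun O fun a => (f a).neg :=
  of_enc (g := fun a => (Data.tag 3, f a)) (by fun_prop) fun _ => rfl

@[fun_prop]
theorem ante {f : α → Cond} (hf : PolyFun O f) : PolyFun O fun a => (f a).ante :=
  of_enc (g := fun a => (enc (f a)).fst) (by fun_prop) fun _ => rfl

@[fun_prop]
theorem conc {f : α → Cond} (hf : PolyFun O f) : PolyFun O fun a => (f a).conc :=
  of_enc (g := fun a => (enc (f a)).snd) (by fun_prop) fun _ => rfl

@[fun_prop]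
theorem mat {f : α → Cond} (hf : PolyFun O f) : PolyFun O fun a => (f a).mat :=
  of_enc (g := fun a => (Data.tag 6, (f a).ante, (f a).conc)) (by fun_prop) fun _ => rfl

/-- Both polarities are computed at once, because negation interchanges them. -/
theorem posL_both : PolyFun O fun a : Fml => (a.posL true, a.posL false) := by
  have hsize : ∀ a : Fml, ∀ b, esize (a.posL b) ≤ esize a := by
    intro a
    induction a with
    | atom p => intro b; cases b <;> simp [Fml.posL, esize, Data.size_tag]
    | bot => intro b; simp [Fml.posL, esize_pos]
    | top => intro b; simp [Fml.posL, esize_pos]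
    | neg a ih =>
      intro b
      have := ih (!b)
      simp [Fml.posL, esize] at *; omega
    | iff a c => intro b; simp [Fml.posL, esize_pos]
    | imp a c iha ihc =>
      intro b
      have h₁ := iha (!b)
      have h₂ := ihc b
      have h₃ := esize_append (a.posL (!b)) (c.posL b)
      simp [Fml.posL, esize] at *; omega
    | _ a c iha ihc =>
      intro b
      have h₁ := iha b
      have h₂ := ihc b
      have h₃ := esize_append (a.posL b) (c.posL b)
      simp [Fml.posL, esize] at *; omega
  have key := fmlRec (O := O) (ε := Unit) (fa := fun _ p => ([p], [])) (fb := fun _ => ([], []))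
    (ft := fun _ => ([], [])) (fn := fun _ r => (r.2, r.1))
    (f₁ := fun _ r s => (r.1 ++ s.1, r.2 ++ s.2)) (f₂ := fun _ r s => (r.1 ++ s.1, r.2 ++ s.2))
    (f₃ := fun _ r s => (r.2 ++ s.1, r.1 ++ s.2)) (f₄ := fun _ _ _ => ([], []))
    (by fun_prop) (by fun_prop) (by fun_prop) (by fun_prop) (by fun_prop) (by fun_prop)
    (by fun_prop) (by fun_prop) (fun _ a => (a.posL true, a.posL false)) (fun _ _ => rfl)
    (fun _ => rfl) (fun _ => rfl) (fun _ _ => rfl) (fun _ _ _ => rfl) (fun _ _ _ => rfl)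
    (fun _ _ _ => rfl) (fun _ _ _ => rfl) (2 * .X) fun e a => by
      have h₁ := hsize a true
      have h₂ := hsize a false
      simp only [esize_pair, Polynomial.eval_mul, Polynomial.eval_X, Polynomial.eval_ofNat]
      omega
  exact key.comp ((const ()).prodMk id)

@[fun_prop]
theorem posL (b : Bool) {f : α → Fml} (hf : PolyFun O f) : PolyFun O fun a => (f a).posL b := by
  have h := posL_both.comp hf
  cases b
  · exact snd.comp h
  · exact fst.comp h

@[fun_prop]
theorem evalIn {M : α → List Name} {f : α → Fml} (hM : PolyFun O M) (hf : PolyFun O f) :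
    PolyFun O fun a => (f a).evalIn (M a) := by
  have key := fmlRec (O := O) (fa := fun M p => DRSL.memB p M) (fb := fun _ => false)
    (ft := fun _ => true) (fn := fun _ r => !r)
    (f₁ := fun _ r s => r && s) (f₂ := fun _ r s => r || s)
    (f₃ := fun _ r s => !r || s) (f₄ := fun _ r s => DRSL.eqB r s)
    (by fun_prop) (by fun_prop) (by fun_prop) (by fun_prop) (by fun_prop) (by fun_prop)
    (by fun_prop) (by fun_prop) (fun M a => a.evalIn M) (fun _ _ => rfl)
    (fun _ => rfl) (fun _ => rfl) (fun _ _ => rfl) (fun _ _ _ => rfl) (fun _ _ _ => rfl)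
    (fun _ _ _ => rfl)
    (fun _ _ _ => by rw [Bool.eq_iff_iff]; simp [Fml.evalIn, Fml.eval]) 3
    fun e a => (esize_bool_le _).trans (by simp)
  exact key.comp (hM.prodMk hf)

/-- Both polarities are computed at once, because negation interchanges them. -/
theorem isClause_both :
    PolyFun O fun a : Fml => (holds (a.IsClause true), holds (a.IsClause false)) := by
  have key := fmlRec (O := O) (ε := Unit) (fa := fun _ _ => (true, true))
    (fb := fun _ => (true, true)) (ft := fun _ => (true, true)) (fn := fun _ r => (r.2, r.1))
    (f₁ := fun _ r s => (false, r.2 && s.2)) (f₂ := fun _ r s => (r.1 && s.1, false))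
    (f₃ := fun _ r s => (r.2 && s.1, false)) (f₄ := fun _ _ _ => (false, false))
    (by fun_prop) (by fun_prop) (by fun_prop) (by fun_prop) (by fun_prop) (by fun_prop)
    (by fun_prop) (by fun_prop)
    (fun _ a => (holds (a.IsClause true), holds (a.IsClause false)))
    (by intros; apply Prod.ext <;> rw [Bool.eq_iff_iff] <;> simp [Fml.IsClause])
    (by intros; apply Prod.ext <;> rw [Bool.eq_iff_iff] <;> simp [Fml.IsClause])
    (by intros; apply Prod.ext <;> rw [Bool.eq_iff_iff] <;> simp [Fml.IsClause])
    (by intros; apply Prod.ext <;> rw [Bool.eq_iff_iff] <;> simp [Fml.IsClause])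
    (by intros; apply Prod.ext <;> rw [Bool.eq_iff_iff] <;> simp [Fml.IsClause])
    (by intros; apply Prod.ext <;> rw [Bool.eq_iff_iff] <;> simp [Fml.IsClause])
    (by intros; apply Prod.ext <;> rw [Bool.eq_iff_iff] <;> simp [Fml.IsClause])
    (by intros; apply Prod.ext <;> rw [Bool.eq_iff_iff] <;> simp [Fml.IsClause]) 7 fun e a => by
      have h₁ := esize_bool_le (holds (a.IsClause true))
      have h₂ := esize_bool_le (holds (a.IsClause false))
      simp only [esize_pair, Polynomial.eval_ofNat]
      omega
  exact key.comp ((const ()).prodMk id)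

@[fun_prop]
theorem hornB {f : α → Fml} (hf : PolyFun O f) : PolyFun O fun a => (f a).hornB := by
  have h := fst.comp (isClause_both.comp hf)
  refine of_enc (h.band (d := fun a => ((f a).posL true).all fun p =>
    ((f a).posL true).all fun q => DRSL.eqB p q) (by fun_prop)) fun a => ?_
  congr 1
  rw [Bool.eq_iff_iff]
  simp [Fml.hornB, Fml.IsHorn, Finset.card_le_one, Fml.mem_posL]

@[fun_prop]
theorem klmCondL {f : α → KLM} (hf : PolyFun O f) : PolyFun O fun a => (f a).condL := by
  refine comp (f := KLM.condL) (gather (leaf := fun φ => !(enc φ).fst.snd.isCons)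
    (base := fun φ => φ.1.condL)
    (l := fun φ => match φ with | ⟨.and φ _, _⟩ => φ | φ => φ.1)
    (r := fun φ => match φ with | ⟨.and _ φ, _⟩ => φ | φ => φ.1)
    (by fun_prop) ?_ ?_ ?_ _ (fun _ => rfl) ?_ ?_) hf
  · refine of_enc (g := fun a => bif DRSL.eqB (enc a.1).fst (.tag 0) then
      [Data.cons (Data.cons (.tag 3) (enc a.1).snd) (enc Fml.bot)] else [(enc a.1).snd])
      (by fun_prop) ?_
    rintro ⟨φ, h⟩
    cases φ with
    | and => exact absurd h Bool.false_ne_true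
    | _ => simp [KLM.condL, DRSL.eqB, enc, KLM.enc, Fml.enc, Data.ofList]
  · refine of_enc (g := fun a => (enc a.1).snd.fst) (by fun_prop) ?_
    rintro ⟨φ, h⟩
    cases φ with
    | and => rfl
    | _ => exact absurd h.symm Bool.false_ne_true
  · refine of_enc (g := fun a => (enc a.1).snd.snd) (by fun_prop) ?_
    rintro ⟨φ, h⟩
    cases φ with
    | and => rfl
    | _ => exact absurd h.symm Bool.false_ne_true
  · rintro ⟨φ, h⟩
    cases φ with
    | and => rfl
    | _ => exact absurd h.symm Bool.false_ne_true
  · rintro ⟨φ, h⟩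
    cases φ with
    | and φ χ => simp only [esize, enc, KLM.enc, Data.size_cons]; omega
    | _ => exact absurd h.symm Bool.false_ne_true

@[fun_prop]
theorem queryLits {f : α → Query} (hf : PolyFun O f) : PolyFun O fun a => (f a).lits := by
  refine comp (f := Query.lits) (gather (leaf := fun φ => !(enc φ).fst.snd.isCons)
    (base := fun φ => φ.1.lits)
    (l := fun φ => match φ with | ⟨.and φ _, _⟩ => φ | φ => φ.1)
    (r := fun φ => match φ with | ⟨.and _ φ, _⟩ => φ | φ => φ.1)
    (by fun_prop) ?_ ?_ ?_ _ (fun _ => rfl) ?_ ?_) hf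
  · refine of_enc (g := fun a => [(DRSL.eqB (enc a.1).fst (.tag 0), (enc a.1).snd)])
      (by fun_prop) ?_
    rintro ⟨φ, h⟩
    cases φ with
    | and => exact absurd h Bool.false_ne_true
    | _ => simp [Query.lits, DRSL.eqB, enc, Query.enc, Data.ofList]
  · refine of_enc (g := fun a => (enc a.1).snd.fst) (by fun_prop) ?_
    rintro ⟨φ, h⟩
    cases φ with
    | and => rfl
    | _ => exact absurd h.symm Bool.false_ne_true
  · refine of_enc (g := fun a => (enc a.1).snd.snd) (by fun_prop) ?_
    rintro ⟨φ, h⟩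
    cases φ with
    | and => rfl
    | _ => exact absurd h.symm Bool.false_ne_true
  · rintro ⟨φ, h⟩
    cases φ with
    | and => rfl
    | _ => exact absurd h.symm Bool.false_ne_true
  · rintro ⟨φ, h⟩
    cases φ with
    | and φ χ => simp only [esize, enc, Query.enc, Data.size_cons]; omega
    | _ => exact absurd h.symm Bool.false_ne_true

@[fun_prop]
theorem itemSp {f : α → Item} (hf : PolyFun O f) : PolyFun O fun a => (f a).sp :=
  of_enc (g := fun a => (enc (f a)).snd.fst) (by fun_prop) fun a => by cases f a <;> rfl

@[fun_prop]
theorem itemIsBox {f : α → Item} (hf : PolyFun O f) : PolyFun O fun a => (f a).isBox :=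
  of_enc (g := fun a => DRSL.eqB (enc (f a)).fst (.tag 0)) (by fun_prop) fun a => by
    cases f a <;> simp [Item.isBox, DRSL.eqB, enc, Item.enc]

@[fun_prop]
theorem itemIsDia {f : α → Item} (hf : PolyFun O f) : PolyFun O fun a => (f a).isDia :=
  of_enc (g := fun a => DRSL.eqB (enc (f a)).fst (.tag 1)) (by fun_prop) fun a => by
    cases f a <;> simp [Item.isDia, DRSL.eqB, enc, Item.enc]

@[fun_prop]
theorem itemIsSharp {f : α → Item} (hf : PolyFun O f) : PolyFun O fun a => (f a).isSharp :=
  of_enc (g := fun a => DRSL.eqB (enc (f a)).fst (.tag 2)) (by fun_prop) fun a => by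
    cases f a <;> simp [Item.isSharp, DRSL.eqB, enc, Item.enc]

@[fun_prop]
theorem itemTarget {f : α → Item} (hf : PolyFun O f) : PolyFun O fun a => (f a).target :=
  of_enc (g := fun a => bif (f a).isSharp then (enc (f a)).snd.snd else enc Standpoint.univ)
    (by fun_prop) fun a => by cases f a <;> rfl

@[fun_prop]
theorem itemKlm {f : α → Item} (hf : PolyFun O f) : PolyFun O fun a => (f a).klm :=
  of_enc (g := fun a => bif (f a).isSharp then enc (KLM.bool Fml.bot) else (enc (f a)).snd.snd)
    (by fun_prop) fun a => by cases f a <;> rfl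

@[fun_prop]
theorem standpointL {K : α → List Item} (hK : PolyFun O K) :
    PolyFun O fun a => standpointL (K a) := by
  unfold DRSL.standpointL
  fun_prop

@[fun_prop]
theorem sharpB {K : α → List Item} {s t : α → Standpoint} (hK : PolyFun O K) (hs : PolyFun O s)
    (ht : PolyFun O t) : PolyFun O fun a => sharpB (K a) (s a) (t a) := by
  unfold DRSL.sharpB DRSL.reachL
  fun_prop

@[fun_prop]
theorem boxL {K : α → List Item} {s : α → Standpoint} (hK : PolyFun O K) (hs : PolyFun O s) :
    PolyFun O fun a => boxL (K a) (s a) := by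
  unfold DRSL.boxL
  fun_prop

@[fun_prop]
theorem knowL {K : α → List Item} {s : α → Standpoint} (hK : PolyFun O K) (hs : PolyFun O s) :
    PolyFun O fun a => knowL (K a) (s a) := by
  unfold DRSL.knowL
  fun_prop

theorem closedWorldB : PolyFun O fun p : List Item × Query => closedWorldB p.1 p.2 := by
  unfold DRSL.closedWorldB
  fun_prop

theorem hornInstanceB : PolyFun O fun p : List Item × Query => hornInstanceB p.1 p.2 := by
  unfold DRSL.hornInstanceB
  fun_prop

variable {ent : List Cond × Fml → Bool} (hent : PolyFun O ent)

include hent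

theorem rcCondB {E : α → List Cond} {c : α → Cond} (hE : PolyFun O E) (hc : PolyFun O c) :
    PolyFun O fun a => rcCondB ent (E a) (c a) := by
  obtain ⟨q, hq⟩ := hE.esize_le
  have h₁ : PolyFun O fun a => (rcStep ent (c a).ante)^[(E a).length] (E a) := by
    refine iterate (f := fun a F => rcStep ent (c a).ante F) ?_ hE hE q fun a k => ?_
    · unfold rcStep
      fun_prop
    · refine le_trans ?_ (hq a)
      induction k with
      | zero => exact le_rfl
      | succ k ih =>
        rw [Function.iterate_succ_apply']
        refine le_trans ?_ ih
        unfold rcStep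
        cases ent _
        · exact le_rfl
        · exact esize_sublist List.filter_sublist
  unfold DRSL.rcCondB
  fun_prop

theorem rcPropB {B : α → List KLM} {φ : α → KLM} (hB : PolyFun O B) (hφ : PolyFun O φ) :
    PolyFun O fun a => rcPropB ent (B a) (φ a) := by
  unfold DRSL.rcPropB
  exact all (by fun_prop) (rcCondB hent (by fun_prop) (by fun_prop))

theorem rcStandpointB : PolyFun O fun p : List Item × Query => rcStandpointB ent p.1 p.2 := by
  unfold DRSL.rcStandpointB DRSL.rcLitB
  exact all (by fun_prop) (cond (by fun_prop)
    (all (by fun_prop) (rcPropB hent (by fun_prop) (by fun_prop)))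
    (any (by fun_prop) (rcPropB hent (by fun_prop) (by fun_prop))))

end PolyFun

/-! ### Rational closure as an iteration -/

open Classical in
/-- One step on the way to the set that decides a query with antecedent `a`: as long as `a` is
refuted, pass to the exceptional implications. -/
noncomputable def closureStep (a : Fml) (E : Finset Cond) : Finset Cond :=
  if Entails E (Fml.neg a) then exceptional E else E

theorem baseRank_of_eq {E : Finset Cond} (h : exceptional E = E) :
    baseRank E = (if E = ∅ then [] else [E \ exceptional E], E) := by
  rw [baseRank, dif_pos h]

theorem baseRank_of_ne {E : Finset Cond} (h : exceptional E ≠ E) :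
    baseRank E = ((E \ exceptional E) :: (baseRank (exceptional E)).1,
      (baseRank (exceptional E)).2) := by
  rw [baseRank, dif_neg h]

theorem card_exceptional_lt {E : Finset Cond} (h : exceptional E ≠ E) :
    (exceptional E).card < E.card :=
  Finset.card_lt_card (Finset.ssubset_iff_subset_ne.mpr ⟨exceptional_subset E, h⟩)

/-- The levels together make up the given set. -/
theorem baseRank_union (E : Finset Cond) :
    (baseRank E).2 ∪ (baseRank E).1.foldr (· ∪ ·) ∅ = E := by
  induction h : E.card using Nat.strong_induction_on generalizing E with
  | _ n ih =>
  subst h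
  by_cases h : exceptional E = E
  · rw [baseRank_of_eq h]
    split <;> simp [h]
  · rw [baseRank_of_ne h]
    have := ih _ (card_exceptional_lt h) (exceptional E) rfl
    simp only [List.foldr_cons]
    rw [Finset.union_left_comm, this, Finset.sdiff_union_of_subset (exceptional_subset E)]

theorem iterate_closureStep_of_eq {a : Fml} {E : Finset Cond} (h : closureStep a E = E) (n : ℕ) :
    (closureStep a)^[n] E = E := Function.iterate_fixed h n

/-- The set that `RCProp` uses to decide a query with antecedent `a` is reached from `E` by
iterating `closureStep a`. -/
theorem union_rcLoop_eq (a : Fml) (E : Finset Cond) (n : ℕ) (hn : E.card ≤ n) :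
    (baseRank E).2 ∪ rcLoop a (baseRank E).2 ((baseRank E).1.foldr (· ∪ ·) ∅) (baseRank E).1 =
      (closureStep a)^[n] E := by
  induction h : E.card using Nat.strong_induction_on generalizing E n with
  | _ k ih =>
  subst h
  by_cases h : exceptional E = E
  · rw [iterate_closureStep_of_eq (by simp [closureStep, h]), baseRank_of_eq h]
    split <;> simp [h, rcLoop]
  · have hU := baseRank_union (exceptional E)
    have hlt := card_exceptional_lt h
    obtain ⟨m, rfl⟩ : ∃ m, n = m + 1 := ⟨n - 1, by omega⟩
    have hrec := ih _ hlt (exceptional E) m (by omega) rfl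
    have hall := baseRank_union E
    rw [baseRank_of_ne h] at hall ⊢
    simp only [List.foldr_cons] at hall ⊢
    set U := (baseRank (exceptional E)).1.foldr (· ∪ ·) ∅ with hUdef
    have hUE : U ⊆ exceptional E := by
      rw [← hU]
      exact Finset.subset_union_right
    have hne : E \ exceptional E ∪ U ≠ ∅ := by
      intro h0
      have := Finset.sdiff_eq_empty_iff_subset.mp (Finset.union_eq_empty.mp h0).1
      exact h (Finset.Subset.antisymm (exceptional_subset E) this)
    have hdiff : (E \ exceptional E ∪ U) \ (E \ exceptional E) = U := by
      ext c
      have := @hUE c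
      simp only [Finset.mem_sdiff, Finset.mem_union]
      tauto
    rw [rcLoop, hall, hdiff]
    by_cases ha : Entails E (Fml.neg a)
    · rw [if_pos ⟨ha, hne⟩, hrec, Function.iterate_succ_apply]
      simp [closureStep, ha]
    · rw [if_neg (fun h => ha h.1), hall, iterate_closureStep_of_eq (by simp [closureStep, ha])]

theorem rcPropCond_iff (E : Finset Cond) (c : Cond) (n : ℕ) (hn : E.card ≤ n) :
    RCPropCond E c ↔ Entails ((closureStep c.ante)^[n] E) c.mat := by
  rw [← union_rcLoop_eq c.ante E n hn]
  rfl

/-! ### Correctness of the algorithms -/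

/-- The test `ent` decides the entailments that come up in the rational closure of implications with
property `P`. -/
def Decides (ent : List Cond × Fml → Bool) (P : Cond → Prop) : Prop :=
  ∀ E : List Cond, (∀ c ∈ E, P c) → ∀ c, P c → ∀ a, a = Fml.neg c.ante ∨ a = c.mat →
    (ent (E, a) = true ↔ Entails E.toFinset a)

section correctness

variable {ent : List Cond × Fml → Bool} {P : Cond → Prop} (hent : Decides ent P)

include hent

/-- The tests concern sets of implications with property `P` only. -/
theorem toFinset_rcStep {F : List Cond} (hF : ∀ c ∈ F, P c) {c : Cond} (hc : P c) :
    (rcStep ent c.ante F).toFinset = closureStep c.ante F.toFinset := by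
  have h := hent F hF c hc _ (Or.inl rfl)
  unfold rcStep closureStep
  by_cases he : Entails F.toFinset (Fml.neg c.ante)
  · rw [if_pos he, h.mpr he, cond_true]
    ext d
    simp only [List.mem_toFinset, List.mem_filter, exceptional, Finset.mem_filter]
    refine and_congr_right fun hd => ?_
    exact hent F hF d (hF d hd) _ (Or.inl rfl)
  · rw [if_neg he, Bool.eq_false_iff.mpr (fun h' => he (h.mp h')), cond_false]

theorem rcCondB_eq_true {E : List Cond} (hE : ∀ c ∈ E, P c) {c : Cond} (hc : P c) :
    rcCondB ent E c = true ↔ RCPropCond E.toFinset c := by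
  have key : ∀ n, (∀ d ∈ (rcStep ent c.ante)^[n] E, P d) ∧
      ((rcStep ent c.ante)^[n] E).toFinset = (closureStep c.ante)^[n] E.toFinset := by
    intro n
    induction n with
    | zero => exact ⟨hE, rfl⟩
    | succ n ih =>
      rw [Function.iterate_succ_apply', Function.iterate_succ_apply', ← ih.2,
        toFinset_rcStep hent ih.1 hc]
      refine ⟨fun d hd => ih.1 d ?_, rfl⟩
      unfold rcStep at hd
      cases h : ent ((rcStep ent c.ante)^[n] E, Fml.neg c.ante) with
      | true =>
        unfold rcStep at h
        rw [h, cond_true] at hd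
        exact List.mem_of_mem_filter hd
      | false =>
        unfold rcStep at h
        rw [h, cond_false] at hd
        exact hd
  rw [rcPropCond_iff _ _ _ (List.toFinset_card_le E), rcCondB, ← (key _).2]
  exact hent _ (key _).1 c hc _ (Or.inr rfl)

theorem rcPropB_eq_true {B : List KLM} {φ : KLM} (hB : ∀ χ ∈ B, ∀ c ∈ χ.conds, P c)
    (hφ : ∀ c ∈ φ.conds, P c) : rcPropB ent B φ = true ↔ RCProp B.toFinset φ := by
  have hset : (B.flatMap KLM.condL).toFinset = B.toFinset.biUnion KLM.conds := by
    ext c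
    simp [KLM.mem_condL]
  simp only [rcPropB, List.all_eq_true, RCProp, KLM.mem_condL]
  refine forall₂_congr fun c hc => ?_
  rw [rcCondB_eq_true hent ?_ (hφ c hc), hset]
  intro d hd
  obtain ⟨χ, hχ, hd⟩ := List.mem_flatMap.mp hd
  exact hB χ hχ d (KLM.mem_condL.mp hd)

end correctness

section standpoints

variable {K : List Item} {s t : Standpoint}

theorem mem_standpointL : s ∈ standpointL K ↔ s ∈ standpoints K.toFinset := by
  simp only [standpointL, standpoints, List.mem_flatMap, Finset.mem_biUnion, List.mem_toFinset]
  refine exists_congr fun i => and_congr_right fun _ => ?_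
  cases i <;> simp [Item.isSharp, Item.sp, Item.target, Item.standpoints]

theorem mem_reachL :
    t ∈ reachL K s ↔ Relation.TransGen (fun a b => Item.sharp a b ∈ K.toFinset) s t := by
  have hmem : ∀ a b, Item.sharp a b ∈ K → b ∈ standpointL K := fun a b h =>
    List.mem_flatMap.mpr ⟨_, h, by simp [Item.isSharp, Item.target]⟩
  simp only [List.mem_toFinset]
  constructor
  · refine sat_induction (fun X hX u _ hT => ?_) t
    obtain ⟨i, hi, h⟩ := List.any_eq_true.mp hT
    cases i with
    | sharp a b =>
      simp only [Item.isSharp, Item.target, Item.sp, Bool.true_and, Bool.and_eq_true,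
        Bool.or_eq_true, eqB_eq_true, memB_eq_true] at h
      obtain ⟨rfl, rfl | ha⟩ := h
      · exact .single hi
      · exact .tail (hX a ha) hi
    | _ => simp [Item.isSharp] at h
  · intro h
    induction h with
    | single h =>
      refine sat_closed (hmem _ _ h) (List.any_eq_true.mpr ⟨_, h, ?_⟩)
      simp [Item.isSharp, Item.target, Item.sp]
    | tail _ h ih =>
      refine sat_closed (hmem _ _ h) (List.any_eq_true.mpr ⟨_, h, ?_⟩)
      have := memB_eq_true.mpr ih
      unfold reachL at this
      simp only [Item.isSharp, Item.target, Item.sp, Bool.true_and, Bool.and_eq_true,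
        Bool.or_eq_true, eqB_eq_true]
      exact ⟨trivial, Or.inr this⟩

theorem sharpB_eq_true : sharpB K s t = true ↔ SharpPlus K.toFinset s t := by
  simp only [sharpB, SharpPlus, Bool.or_eq_true, eqB_eq_true, memB_eq_true, mem_reachL, or_assoc]

theorem toFinset_boxL : (boxL K s).toFinset = boxBase K.toFinset s := by
  ext φ
  simp only [boxL, boxBase, List.mem_toFinset, List.mem_map, List.mem_filter, Finset.mem_biUnion,
    Bool.and_eq_true, sharpB_eq_true, and_assoc]
  refine exists_congr fun i => and_congr_right fun _ => ?_
  cases i with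
  | box t χ =>
    simp only [Item.isBox, Item.sp, Item.klm, true_and]
    split <;> rename_i h <;> simp [h, eq_comm]
  | _ => simp [Item.isBox]

/-- `knowL` lists `know`; the members of the latter are finite sets, those of the former lists. -/
theorem mem_know_iff (B : Finset KLM) :
    B ∈ know K.toFinset s ↔ ∃ L ∈ knowL K s, L.toFinset = B := by
  have key : ∀ t L, (L ∈ (bif eqB s Standpoint.univ && eqB t Standpoint.univ then []
        else [boxL K t]) ++
      (K.filter fun i => i.isDia && eqB i.sp t).map fun i => i.klm :: boxL K t) ↔
      (¬(s = Standpoint.univ ∧ t = Standpoint.univ) ∧ L = boxL K t) ∨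
        ∃ φ, Item.dia t φ ∈ K ∧ L = φ :: boxL K t := by
    intro t L
    rw [List.mem_append]
    refine or_congr ?_ ?_
    · cases h : eqB s Standpoint.univ && eqB t Standpoint.univ with
      | true => simp_all
      | false =>
        have : ¬(s = Standpoint.univ ∧ t = Standpoint.univ) := by
          rintro ⟨rfl, rfl⟩
          simp [eqB] at h
        simp [this]
    · simp only [List.mem_map, List.mem_filter, Bool.and_eq_true, eqB_eq_true]
      constructor
      · rintro ⟨i, ⟨hi, hd, rfl⟩, rfl⟩
        cases i with
        | dia t φ => exact ⟨φ, hi, rfl⟩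
        | _ => simp [Item.isDia] at hd
      · rintro ⟨φ, hφ, rfl⟩
        exact ⟨_, ⟨hφ, rfl, rfl⟩, rfl⟩
  constructor
  · rintro ⟨t, ht, hts, h⟩
    have hmem : ∀ L, (¬(s = Standpoint.univ ∧ t = Standpoint.univ) ∧ L = boxL K t) ∨
        (∃ φ, Item.dia t φ ∈ K ∧ L = φ :: boxL K t) → L ∈ knowL K s := fun L hL =>
      List.mem_flatMap.mpr ⟨t, mem_standpointL.mpr ht, by
        rw [sharpB_eq_true.mpr hts, cond_true]
        exact (key t L).mpr hL⟩
    rcases h with ⟨h, rfl⟩ | ⟨φ, hφ, rfl⟩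
    · exact ⟨_, hmem _ (Or.inl ⟨h, rfl⟩), toFinset_boxL⟩
    · exact ⟨_, hmem _ (Or.inr ⟨φ, List.mem_toFinset.mp hφ, rfl⟩), by
        rw [List.toFinset_cons, toFinset_boxL]⟩
  · rintro ⟨L, hL, rfl⟩
    obtain ⟨t, ht, hL⟩ := List.mem_flatMap.mp hL
    cases hts : sharpB K t s with
    | false => simp [hts] at hL
    | true =>
      rw [hts, cond_true] at hL
      refine ⟨t, mem_standpointL.mp ht, sharpB_eq_true.mp hts, ?_⟩
      rcases (key t L).mp hL with ⟨h, rfl⟩ | ⟨φ, hφ, rfl⟩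
      · exact Or.inl ⟨h, toFinset_boxL⟩
      · exact Or.inr ⟨φ, List.mem_toFinset.mpr hφ, by rw [List.toFinset_cons, toFinset_boxL]⟩

theorem closedWorldB_eq_true {ψ : Query} :
    closedWorldB K ψ = true ↔ ClosedWorld K.toFinset ψ := by
  unfold closedWorldB ClosedWorld
  induction ψ with
  | and ψ χ ihψ ihχ =>
    simp only [Query.lits, List.all_append, Bool.and_eq_true, ihψ, ihχ, Query.standpoints,
      Finset.union_subset_iff]
  | _ s φ => simp [Query.lits, Query.standpoints, mem_standpointL]

theorem hornInstanceB_eq_true {ψ : Query} :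
    hornInstanceB K ψ = true ↔ (∀ i ∈ K, i.IsHorn) ∧ ψ.IsHorn := by
  have hφ : ∀ φ : KLM, (φ.condL.all fun c => c.mat.hornB) = true ↔ φ.IsHorn := by
    intro φ
    simp [KLM.IsHorn, Fml.hornB, KLM.mem_condL]
  unfold hornInstanceB
  rw [Bool.and_eq_true, List.all_eq_true]
  refine and_congr (forall₂_congr fun i _ => ?_) ?_
  · rw [Bool.or_eq_true, hφ]
    cases i <;> simp [Item.isSharp, Item.klm, Item.IsHorn]
  · induction ψ with
    | and ψ χ ihψ ihχ =>
      rw [Query.lits, List.all_append, Bool.and_eq_true, ihψ, ihχ]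
      rfl
    | _ s φ => simpa [Query.lits, Query.IsHorn] using hφ φ

/-- The defeasible implications in a member of a knowledge base have the property `P`. -/
def Item.Forall (P : Cond → Prop) (i : Item) : Prop :=
  i.isSharp = false → ∀ c ∈ i.klm.conds, P c

/-- The defeasible implications in a query have the property `P`. -/
def Query.Forall (P : Cond → Prop) : Query → Prop
  | box _ φ => ∀ c ∈ φ.conds, P c
  | dia _ φ => ∀ c ∈ φ.conds, P c
  | and ψ χ => ψ.Forall P ∧ χ.Forall P

theorem forall_of_mem_knowL {P : Cond → Prop} (hK : ∀ i ∈ K, i.Forall P) {L : List KLM}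
    (hL : L ∈ knowL K s) : ∀ χ ∈ L, ∀ c ∈ χ.conds, P c := by
  have hbox : ∀ t, ∀ χ ∈ boxL K t, ∀ c ∈ χ.conds, P c := by
    intro t χ hχ
    obtain ⟨i, hi, rfl⟩ := List.mem_map.mp hχ
    rw [List.mem_filter, Bool.and_eq_true] at hi
    exact hK i hi.1 (by cases i <;> simp_all [Item.isBox, Item.isSharp])
  obtain ⟨t, _, hL⟩ := List.mem_flatMap.mp hL
  cases h : sharpB K t s with
  | false => simp [h] at hL
  | true =>
    rw [h, cond_true, List.mem_append] at hL
    rcases hL with hL | hL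
    · cases h' : eqB s Standpoint.univ && eqB t Standpoint.univ with
      | true => simp [h'] at hL
      | false =>
        rw [h', cond_false, List.mem_singleton] at hL
        subst hL
        exact hbox t
    · obtain ⟨i, hi, rfl⟩ := List.mem_map.mp hL
      rw [List.mem_filter, Bool.and_eq_true] at hi
      intro χ hχ
      rcases List.mem_cons.mp hχ with rfl | hχ
      · exact hK i hi.1 (by cases i <;> simp_all [Item.isDia, Item.isSharp])
      · exact hbox t χ hχ

theorem rcStandpointB_eq_true {ent : List Cond × Fml → Bool} {P : Cond → Prop}
    (hent : Decides ent P) (hK : ∀ i ∈ K, i.Forall P) {ψ : Query} (hψ : ψ.Forall P) :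
    rcStandpointB ent K ψ = true ↔ RCStandpoint K.toFinset ψ := by
  have hprop : ∀ (s : Standpoint) (φ : KLM), (∀ c ∈ φ.conds, P c) → ∀ L ∈ knowL K s,
      (rcPropB ent L φ = true ↔ RCProp L.toFinset φ) := fun s φ hφ L hL =>
    rcPropB_eq_true hent (forall_of_mem_knowL hK hL) hφ
  unfold rcStandpointB
  induction ψ with
  | box s φ =>
    simp only [Query.lits, List.all_cons, List.all_nil, Bool.and_true, rcLitB, cond_true,
      List.all_eq_true, RCStandpoint, mem_know_iff]
    constructor
    · rintro h _ ⟨L, hL, rfl⟩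
      exact (hprop s φ hψ L hL).mp (h L hL)
    · intro h L hL
      exact (hprop s φ hψ L hL).mpr (h _ ⟨L, hL, rfl⟩)
  | dia s φ =>
    simp only [Query.lits, List.all_cons, List.all_nil, Bool.and_true, rcLitB, cond_false,
      List.any_eq_true, RCStandpoint, mem_know_iff]
    constructor
    · rintro ⟨L, hL, h⟩
      exact ⟨_, ⟨L, hL, rfl⟩, (hprop s φ hψ L hL).mp h⟩
    · rintro ⟨_, ⟨L, hL, rfl⟩, h⟩
      exact ⟨L, hL, (hprop s φ hψ L hL).mpr h⟩
  | and ψ χ ihψ ihχ =>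
    rw [Query.lits, List.all_append, Bool.and_eq_true]
    exact and_congr (ihψ hψ.1) (ihχ hψ.2)

end standpoints

/-! ### Entailment between Horn clauses -/

/-- A clause (or, for `false`, a negated clause) that holds remains so when atoms are made false
that do not occur positively in it. -/
theorem Fml.IsClause.eval_anti {b : Bool} {a : Fml} (ha : a.IsClause b) {v w : Name → Bool}
    (hvw : ∀ p, v p = true → w p = true) (hpos : ∀ p ∈ a.posAtoms b, w p = true → v p = true)
    (h : a.eval w = b) : a.eval v = b := by
  induction a generalizing b with
  | atom p =>
    cases b with
    | true => exact hpos p (by simp [posAtoms]) h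
    | false =>
      simp only [eval] at h ⊢
      exact Bool.eq_false_iff.mpr fun h' => by simp [hvw p h'] at h
  | bot => exact h
  | top => exact h
  | neg a ih =>
    have := ih (b := !b) (by cases b <;> exact ha) (by cases b <;> exact hpos)
      (by simp only [eval] at h; simp [← h])
    simp [eval, this]
  | and a c iha ihc =>
    cases b with
    | true => exact ha.elim
    | false =>
      simp only [IsClause, posAtoms, eval, Finset.mem_union, Bool.and_eq_false_iff] at *
      exact h.imp (iha ha.1 fun p hp => hpos p (.inl hp)) (ihc ha.2 fun p hp => hpos p (.inr hp))
  | or a c iha ihc =>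
    cases b with
    | false => exact ha.elim
    | true =>
      simp only [IsClause, posAtoms, eval, Finset.mem_union, Bool.or_eq_true] at *
      exact h.imp (iha ha.1 fun p hp => hpos p (.inl hp)) (ihc ha.2 fun p hp => hpos p (.inr hp))
  | imp a c iha ihc =>
    cases b with
    | false => exact ha.elim
    | true =>
      simp only [IsClause, posAtoms, eval, Finset.mem_union, Bool.or_eq_true,
        Bool.not_eq_true', Bool.not_true] at *
      exact h.imp (iha ha.1 fun p hp => hpos p (.inl hp)) (ihc ha.2 fun p hp => hpos p (.inr hp))
  | iff a c => cases b <;> exact ha.elim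

/-- A valuation that refutes a clause makes all its negative atoms true. -/
theorem Fml.IsClause.eq_true_of_eval {b : Bool} {a : Fml} (ha : a.IsClause b) {w : Name → Bool}
    (h : a.eval w = !b) : ∀ p ∈ a.posAtoms (!b), w p = true := by
  induction a generalizing b with
  | atom p => cases b <;> simp_all [posAtoms, eval]
  | bot => cases b <;> simp [posAtoms]
  | top => cases b <;> simp [posAtoms]
  | neg a ih =>
    have := ih (b := !b) (by cases b <;> exact ha) (by simp only [eval] at h; simpa using h)
    cases b <;> simpa [posAtoms] using this
  | and a c iha ihc =>
    cases b with
    | true => exact ha.elim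
    | false =>
      simp only [IsClause, posAtoms, eval, Finset.mem_union, Bool.not_false,
        Bool.and_eq_true] at *
      exact fun p hp => hp.elim (iha ha.1 h.1 p) (ihc ha.2 h.2 p)
  | or a c iha ihc =>
    cases b with
    | false => exact ha.elim
    | true =>
      simp only [IsClause, posAtoms, eval, Finset.mem_union, Bool.not_true,
        Bool.or_eq_false_iff] at *
      exact fun p hp => hp.elim (iha ha.1 h.1 p) (ihc ha.2 h.2 p)
  | imp a c iha ihc =>
    cases b with
    | false => exact ha.elim
    | true =>
      simp only [IsClause, posAtoms, eval, Finset.mem_union, Bool.not_true,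
        Bool.or_eq_false_iff, Bool.not_eq_false', Bool.not_false] at *
      exact fun p hp => hp.elim (iha (b := false) ha.1 h.1 p) (ihc ha.2 h.2 p)
  | iff a c => cases b <;> exact ha.elim

/-- A clause that is refuted remains so when atoms are made false that do not occur negatively in
it. -/
theorem Fml.IsClause.eval_eq_not {b : Bool} {a : Fml} (ha : a.IsClause b) {v w : Name → Bool}
    (hvw : ∀ p, v p = true → w p = true) (hneg : ∀ p ∈ a.posAtoms (!b), v p = true)
    (h : a.eval w = !b) : a.eval v = !b := by
  induction a generalizing b with
  | atom p =>
    cases b with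
    | false => exact hneg p (by simp [posAtoms])
    | true =>
      simp only [eval, Bool.not_true] at h ⊢
      exact Bool.eq_false_iff.mpr fun h' => by simp [hvw p h'] at h
  | bot => exact h
  | top => exact h
  | neg a ih =>
    have := ih (b := !b) (by cases b <;> exact ha) (by cases b <;> simpa [posAtoms] using hneg)
      (by simp only [eval] at h; simpa using h)
    simp [eval, this]
  | and a c iha ihc =>
    cases b with
    | true => exact ha.elim
    | false =>
      simp only [IsClause, posAtoms, eval, Finset.mem_union, Bool.not_false,
        Bool.and_eq_true] at *
      exact ⟨iha ha.1 (fun p hp => hneg p (.inl hp)) h.1,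
        ihc ha.2 (fun p hp => hneg p (.inr hp)) h.2⟩
  | or a c iha ihc =>
    cases b with
    | false => exact ha.elim
    | true =>
      simp only [IsClause, posAtoms, eval, Finset.mem_union, Bool.not_true,
        Bool.or_eq_false_iff] at *
      exact ⟨iha ha.1 (fun p hp => hneg p (.inl hp)) h.1,
        ihc ha.2 (fun p hp => hneg p (.inr hp)) h.2⟩
  | imp a c iha ihc =>
    cases b with
    | false => exact ha.elim
    | true =>
      simp only [IsClause, posAtoms, eval, Finset.mem_union, Bool.not_true,
        Bool.or_eq_false_iff, Bool.not_eq_false', Bool.not_false] at *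
      exact ⟨iha (b := false) ha.1 (fun p hp => hneg p (.inl hp)) h.1,
        ihc ha.2 (fun p hp => hneg p (.inr hp)) h.2⟩
  | iff a c => cases b <;> exact ha.elim

/-- The atoms that are derived by forward chaining from the negative atoms of `a` with the clauses
in `E`: if a clause is false, then its positive atom is added. -/
noncomputable def chain (E : List Cond) (a : Fml) : List Name :=
  sat (E.flatMap (fun c => c.mat.posL true) ++ a.posL false) fun X u =>
    memB u (a.posL false) || E.any fun c => memB u (c.mat.posL true) && !c.mat.evalIn X

/-- The entailment test for Horn clauses: chaining leads to a contradiction, or `a` is true in the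
model that it leads to. -/
noncomputable def hornEntails (p : List Cond × Fml) : Bool :=
  (p.1.any fun c => !c.mat.evalIn (chain p.1 p.2)) || p.2.evalIn (chain p.1 p.2)

theorem PolyFun.hornEntails {O : Set Data} : PolyFun O hornEntails := by
  have : PolyFun O fun p : List Cond × Fml => chain p.1 p.2 := by
    unfold chain
    fun_prop
  unfold DRSL.hornEntails
  fun_prop

theorem mem_chain_of_mem {E : List Cond} {a : Fml} {p : Name} (h : p ∈ a.posAtoms false) :
    p ∈ chain E a := by
  have h := Fml.mem_posL.mpr h
  refine sat_closed (List.mem_append_right _ h) ?_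
  rw [memB_eq_true.mpr h, Bool.true_or]

theorem mem_chain_of_eval {E : List Cond} {a : Fml} {c : Cond} (hc : c ∈ E)
    (h : c.mat.evalIn (chain E a) = false) {p : Name} (hp : p ∈ c.mat.posAtoms true) :
    p ∈ chain E a := by
  have hp := Fml.mem_posL.mpr hp
  refine sat_closed (List.mem_append_left _ (List.mem_flatMap.mpr ⟨c, hc, hp⟩)) ?_
  rw [Bool.or_eq_true]
  right
  refine List.any_eq_true.mpr ⟨c, hc, ?_⟩
  rw [memB_eq_true.mpr hp, Bool.true_and]
  unfold chain at h
  rw [h]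
  rfl

/-- The derived atoms are true in every countermodel. So a countermodel exists only if the derived
model satisfies `E` and refutes `a`, and then the derived model is a countermodel itself. -/
theorem hornEntails_eq_true {E : List Cond} (hE : ∀ c ∈ E, c.mat.IsHorn) {a : Fml}
    (ha : a.IsClause true) : hornEntails (E, a) = true ↔ Entails E.toFinset a := by
  constructor
  · intro h v hv
    by_contra hav
    rw [Bool.not_eq_true] at hav
    -- every model of `E` that refutes `a` extends the set of derived atoms
    have hle : ∀ p ∈ chain E a, v p = true := by
      refine sat_induction fun X hX u _ hT => ?_
      rw [Bool.or_eq_true] at hT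
      rcases hT with hu | hu
      · exact ha.eq_true_of_eval hav u (Fml.mem_posL.mp (memB_eq_true.mp hu))
      · obtain ⟨c, hc, hu⟩ := List.any_eq_true.mp hu
        rw [Bool.and_eq_true, memB_eq_true, Fml.mem_posL, Bool.not_eq_true'] at hu
        by_contra huv
        refine Bool.eq_false_iff.mp hu.2 ((hE c hc).1.eval_anti (w := v) ?_ ?_
          (hv c (List.mem_toFinset.mpr hc)))
        · exact fun p hp => hX p (memB_eq_true.mp hp)
        · intro p hp hpv
          rw [Finset.card_le_one.mp (hE c hc).2 p hp u hu.1] at hpv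
          exact absurd hpv huv
    have hle' : ∀ p, memB p (chain E a) = true → v p = true := fun p hp =>
      hle p (memB_eq_true.mp hp)
    rcases Bool.or_eq_true _ _ ▸ h with h | h
    · obtain ⟨c, hc, h⟩ := List.any_eq_true.mp h
      rw [Bool.not_eq_true'] at h
      exact Bool.eq_false_iff.mp h ((hE c hc).1.eval_anti hle'
        (fun p hp _ => memB_eq_true.mpr (mem_chain_of_eval hc h hp))
        (hv c (List.mem_toFinset.mpr hc)))
    · have := ha.eval_eq_not hle' (fun p hp => memB_eq_true.mpr (mem_chain_of_mem hp)) hav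
      exact Bool.eq_false_iff.mp this h
  · intro h
    rw [hornEntails, Bool.or_eq_true, or_iff_not_imp_left]
    intro hE
    refine h _ fun c hc => ?_
    by_contra hc'
    exact hE (List.any_eq_true.mpr ⟨c, List.mem_toFinset.mp hc, by
      rw [Bool.not_eq_true', ← Bool.not_eq_true]
      exact hc'⟩)

theorem decides_hornEntails : Decides hornEntails fun c => c.mat.IsHorn := by
  intro E hE c hc a ha
  refine hornEntails_eq_true hE ?_
  rcases ha with rfl | rfl
  · exact hc.1.1
  · exact hc.1

/-! ### Recognition of encodings -/

/-- Whether a tree stands for an element of `α`. -/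
noncomputable def isEnc (α : Type) [Enc α] (d : Data) : Bool := holds (∃ a : α, enc a = d)

/-- The list that a tree stands for, as a right comb. -/
def Data.toList : Data → List Data
  | nil => []
  | cons a b => a :: b.toList

theorem Data.enc_toList (d : Data) : enc d.toList = d := by
  induction d with
  | nil => rfl
  | cons a b _ ih => rw [toList, enc_cons, ih, enc_data]

theorem Data.toList_enc {α : Type} [Enc α] (l : List α) : (enc l).toList = l.map enc := by
  induction l with
  | nil => rfl
  | cons a l ih => rw [enc_cons, toList, ih, List.map_cons]

theorem exists_enc_fml {d : Data} : (∃ a : Fml, enc a = d) ↔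
    (∃ p : Name, d = .cons (.tag 0) (enc p)) ∨ d = .cons (.tag 1) .nil ∨
    d = .cons (.tag 2) .nil ∨ (∃ a : Fml, d = .cons (.tag 3) (enc a)) ∨
    ∃ n, 4 ≤ n ∧ n ≤ 7 ∧ ∃ a b : Fml, d = .cons (.tag n) (.cons (enc a) (enc b)) := by
  constructor
  · rintro ⟨a, rfl⟩
    cases a <;> simp
  · rintro (⟨p, rfl⟩ | rfl | rfl | ⟨a, rfl⟩ | ⟨n, h₁, h₂, a, b, rfl⟩)
    · exact ⟨.atom p, rfl⟩
    · exact ⟨.bot, rfl⟩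
    · exact ⟨.top, rfl⟩
    · exact ⟨.neg a, rfl⟩
    · interval_cases n
      · exact ⟨.and a b, rfl⟩
      · exact ⟨.or a b, rfl⟩
      · exact ⟨.imp a b, rfl⟩
      · exact ⟨.iff a b, rfl⟩

/-- The recognizable types: it can be tested in polynomial time whether a tree stands for one of
their elements. -/
class Recognizable (O : Set Data) (α : Type) [Enc α] : Prop where
  polyFun : PolyFun O (isEnc α)

namespace PolyFun

variable {O : Set Data} {α β : Type} [Enc α] [Enc β]

@[fun_prop]
theorem isEnc [h : Recognizable O β] {f : α → Data} (hf : PolyFun O f) :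
    PolyFun O fun a => isEnc β (f a) := h.polyFun.comp hf

end PolyFun

section recognizable

variable {O : Set Data} {α β : Type} [Enc α] [Enc β]

instance : Recognizable O Bool := ⟨PolyFun.of_enc
  (g := fun d : Data => eqB d .nil || eqB d (.cons .nil .nil)) (by fun_prop) fun d => by
    congr 1
    rw [Bool.eq_iff_iff]
    simp only [isEnc, holds_eq_true, Bool.or_eq_true, eqB_eq_true]
    constructor
    · rintro ⟨b, rfl⟩
      cases b
      · exact .inl rfl
      · exact .inr rfl
    · rintro (rfl | rfl)
      · exact ⟨false, rfl⟩
      · exact ⟨true, rfl⟩⟩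

instance [Recognizable O α] [Recognizable O β] : Recognizable O (α × β) := ⟨PolyFun.of_enc
  (g := fun d : Data => d.isCons && (isEnc α d.fst && isEnc β d.snd)) (by fun_prop) fun d => by
    congr 1
    rw [Bool.eq_iff_iff]
    simp only [isEnc, holds_eq_true, Bool.and_eq_true]
    constructor
    · rintro ⟨⟨a, b⟩, rfl⟩
      exact ⟨rfl, ⟨a, rfl⟩, ⟨b, rfl⟩⟩
    · rintro ⟨hd, ⟨a, ha⟩, ⟨b, hb⟩⟩
      obtain ⟨x, y, rfl⟩ := Data.isCons_eq_true.mp hd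
      exact ⟨(a, b), by rw [enc_pair, ha, hb]; rfl⟩⟩

instance [Recognizable O α] : Recognizable O (List α) := by
  have : PolyFun O Data.toList := PolyFun.retype fun d => d.enc_toList
  refine ⟨PolyFun.of_enc (g := fun d : Data => d.toList.all fun x => isEnc α x)
    (PolyFun.all this (by fun_prop)) fun d => ?_⟩
  congr 1
  rw [Bool.eq_iff_iff]
  simp only [isEnc, holds_eq_true, List.all_eq_true]
  constructor
  · rintro ⟨l, rfl⟩
    rw [Data.toList_enc]
    intro x hx
    obtain ⟨a, _, rfl⟩ := List.mem_map.mp hx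
    exact ⟨a, rfl⟩
  · intro h
    induction d with
    | nil => exact ⟨[], rfl⟩
    | cons x y _ ih =>
      obtain ⟨a, ha⟩ := h x (by simp [Data.toList])
      obtain ⟨l, hl⟩ := ih fun z hz => h z (by simp [Data.toList, hz])
      exact ⟨a :: l, by rw [enc_cons, ha, hl]⟩

instance : Recognizable O Standpoint := ⟨PolyFun.of_enc
  (g := fun d : Data => eqB d .nil || (d.isCons && (eqB d.fst .nil && isEnc Name d.snd)))
  (by fun_prop) fun d => by
    congr 1
    rw [Bool.eq_iff_iff]
    cases d with
    | nil => simp only [isEnc, holds_eq_true]; exact iff_of_true ⟨.univ, rfl⟩ (by simp)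
    | cons a b =>
      simp only [isEnc, holds_eq_true, eqB_eq_true, Bool.or_eq_true, Bool.and_eq_true,
        Data.isCons_cons, reduceCtorEq, false_or, true_and, Data.fst_cons, Data.snd_cons]
      constructor
      · rintro ⟨s, hs⟩
        cases s with
        | univ => simp [enc, Standpoint.enc] at hs
        | named s =>
          simp only [enc, Standpoint.enc, Data.cons.injEq] at hs
          exact ⟨hs.1.symm, s, hs.2⟩
      · rintro ⟨rfl, s, rfl⟩
        exact ⟨.named s, rfl⟩⟩

/-- Recognition of trees with two parts (found by `l` and `r`) that are to be recognized in the same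
way. -/
theorem PolyFun.conjunction {leaf base : Data → Bool} {l r : Data → Data} (hleaf : PolyFun O leaf)
    (hbase : PolyFun O base) (hl : PolyFun O l) (hr : PolyFun O r) (R : Data → Bool)
    (hR₁ : ∀ d, leaf d = true → R d = base d)
    (hR₂ : ∀ d, leaf d = false → R d = (R (l d) && R (r d)))
    (hsize : ∀ d, leaf d = false → (l d).size + (r d).size < d.size) : PolyFun O R := by
  refine recursion (base := fun d => base d.1) (l := fun d => l d.1) (r := fun d => r d.1)
    (comb := fun p => p.2.1 && p.2.2) hleaf (by fun_prop) (by fun_prop) (by fun_prop)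
    (by fun_prop) R (fun d => hR₁ d.1 d.2) (fun d => hR₂ d.1 d.2) Data.size
    (fun d => d.size + 3) (.X + 3) (fun d => hsize d.1 d.2) ?_ ?_ ?_ ?_ ?_ ?_
  · intro d
    have := hsize d.1 d.2
    omega
  · intro d
    have := hsize d.1 d.2
    omega
  · exact fun d => Nat.le_add_right _ _
  · exact fun d => (esize_bool_le _).trans (Nat.le_add_left _ _)
  · exact fun d => Nat.le_add_right _ _
  · intro d
    simp [esize]

theorem isEnc_fml_neg (d : Data) : isEnc Fml (.cons (.tag 3) d) = isEnc Fml d := by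
  rw [Bool.eq_iff_iff]
  unfold isEnc
  rw [holds_eq_true, exists_enc_fml, holds_eq_true]
  constructor
  · rintro (⟨p, h⟩ | h | h | ⟨a, h⟩ | ⟨n, h₁, h₂, a, b, h⟩) <;>
      simp only [Data.cons.injEq, Data.tag_inj] at h
    · omega
    · omega
    · omega
    · exact ⟨a, h.2.symm⟩
    · omega
  · rintro ⟨a, rfl⟩
    exact .inr (.inr (.inr (.inl ⟨a, rfl⟩)))

theorem isEnc_fml_binary {n : ℕ} (h₄ : 4 ≤ n) (h₇ : n ≤ 7) (d e : Data) :
    isEnc Fml (.cons (.tag n) (.cons d e)) = (isEnc Fml d && isEnc Fml e) := by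
  rw [Bool.eq_iff_iff]
  unfold isEnc
  rw [holds_eq_true, exists_enc_fml, Bool.and_eq_true, holds_eq_true, holds_eq_true]
  constructor
  · rintro (⟨p, h⟩ | h | h | ⟨a, h⟩ | ⟨m, h₁, h₂, a, b, h⟩) <;>
      simp only [Data.cons.injEq, Data.tag_inj] at h
    · omega
    · omega
    · omega
    · omega
    · exact ⟨⟨a, h.2.1.symm⟩, ⟨b, h.2.2.symm⟩⟩
  · rintro ⟨⟨a, rfl⟩, ⟨b, rfl⟩⟩
    exact .inr (.inr (.inr (.inr ⟨n, h₄, h₇, a, b, rfl⟩)))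

/-- The trees at which the recognition of formulas branches. -/
theorem fml_split {d : Data}
    (hd : (!(eqB d.fst (.tag 3) || (d.snd.isCons && (eqB d.fst (.tag 4) ||
      eqB d.fst (.tag 5) || eqB d.fst (.tag 6) || eqB d.fst (.tag 7))))) = false) :
    (∃ c, d = .cons (.tag 3) c) ∨
      ∃ n, 4 ≤ n ∧ n ≤ 7 ∧ ∃ x y, d = .cons (.tag n) (.cons x y) := by
  simp only [Bool.not_eq_false', Bool.or_eq_true, Bool.and_eq_true, eqB_eq_true] at hd
  cases d with
  | nil => simp [Data.fst, Data.snd, Data.tag] at hd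
  | cons t c =>
    rcases hd with h | ⟨hc, h⟩
    · exact .inl ⟨c, by rw [← h]; rfl⟩
    · obtain ⟨x, y, rfl⟩ := Data.isCons_eq_true.mp hc
      right
      rcases h with ((h | h) | h) | h
      · exact ⟨4, by omega, by omega, x, y, by rw [← h]; rfl⟩
      · exact ⟨5, by omega, by omega, x, y, by rw [← h]; rfl⟩
      · exact ⟨6, by omega, by omega, x, y, by rw [← h]; rfl⟩
      · exact ⟨7, by omega, by omega, x, y, by rw [← h]; rfl⟩

instance : Recognizable O Fml := by
  refine ⟨PolyFun.conjunction
    (leaf := fun d => !(eqB d.fst (.tag 3) || (d.snd.isCons && (eqB d.fst (.tag 4) ||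
      eqB d.fst (.tag 5) || eqB d.fst (.tag 6) || eqB d.fst (.tag 7)))))
    (base := fun d => d.isCons && ((eqB d.fst (.tag 0) && isEnc Name d.snd) ||
      ((eqB d.fst (.tag 1) || eqB d.fst (.tag 2)) && eqB d.snd .nil)))
    -- a negation has one part only; `⊥` serves as its second part
    (l := fun d => bif eqB d.fst (.tag 3) then d.snd else d.snd.fst)
    (r := fun d => bif eqB d.fst (.tag 3) then enc Fml.bot else d.snd.snd)
    (by fun_prop) (by fun_prop) (by fun_prop) (by fun_prop) _ ?_ ?_ ?_⟩
  · intro d hd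
    simp only [Bool.not_eq_true', Bool.or_eq_false_iff, eqB_eq_false,
      Bool.and_eq_false_imp] at hd
    rw [Bool.eq_iff_iff]
    simp only [isEnc, holds_eq_true, Bool.and_eq_true, Bool.or_eq_true, eqB_eq_true,
      exists_enc_fml (d := d)]
    constructor
    · rintro (⟨p, rfl⟩ | rfl | rfl | ⟨a, rfl⟩ | ⟨n, h₁, h₂, a, b, rfl⟩)
      · exact ⟨rfl, .inl ⟨rfl, p, rfl⟩⟩
      · exact ⟨rfl, .inr ⟨.inl rfl, rfl⟩⟩
      · exact ⟨rfl, .inr ⟨.inr rfl, rfl⟩⟩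
      · exact absurd rfl hd.1
      · have := hd.2 rfl
        simp only [Data.fst_cons, ne_eq, Data.tag_inj] at this
        omega
    · rintro ⟨hc, h⟩
      obtain ⟨t, c, rfl⟩ := Data.isCons_eq_true.mp hc
      rcases h with ⟨rfl, p, rfl⟩ | ⟨rfl | rfl, rfl⟩
      · exact .inl ⟨p, rfl⟩
      · exact .inr (.inl rfl)
      · exact .inr (.inr (.inl rfl))
  · intro d hd
    have hbot : isEnc Fml (enc Fml.bot) = true := holds_eq_true.mpr ⟨.bot, rfl⟩
    rcases fml_split hd with ⟨c, rfl⟩ | ⟨n, h₄, h₇, x, y, rfl⟩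
    · rw [isEnc_fml_neg, Data.fst_cons, eqB_eq_true.mpr rfl, cond_true, cond_true, hbot,
        Bool.and_true, Data.snd_cons]
    · have : eqB (Data.tag n) (Data.tag 3) = false := by simp; omega
      rw [isEnc_fml_binary h₄ h₇, Data.fst_cons, this]
      rfl
  · intro d hd
    rcases fml_split hd with ⟨c, rfl⟩ | ⟨n, h₄, h₇, x, y, rfl⟩
    · rw [Data.fst_cons, eqB_eq_true.mpr rfl, cond_true, cond_true]
      simp [Data.size_tag]
      omega
    · have : eqB (Data.tag n) (Data.tag 3) = false := by simp; omega
      rw [Data.fst_cons, this]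
      simp
      omega

instance : Recognizable O Cond := ⟨PolyFun.of_enc (g := isEnc (Fml × Fml)) (by fun_prop) fun d => by
    congr 1
    rw [Bool.eq_iff_iff]
    simp only [isEnc, holds_eq_true]
    exact ⟨fun ⟨c, hc⟩ => ⟨(c.ante, c.conc), hc⟩, fun ⟨p, hp⟩ => ⟨⟨p.1, p.2⟩, hp⟩⟩⟩

/-- Recognition of the trees that are built with the tag of conjunctions from basic ones. -/
theorem PolyFun.conjunctions {base : Data → Bool} (hbase : PolyFun O base) {S : Set Data}
    (hS₁ : ∀ d, (¬∃ x y, d = .cons (.tag 2) (.cons x y)) → (d ∈ S ↔ base d = true))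
    (hS₂ : ∀ x y, .cons (.tag 2) (.cons x y) ∈ S ↔ x ∈ S ∧ y ∈ S) :
    PolyFun O fun d : Data => holds (d ∈ S) := by
  have hsplit : ∀ d : Data, (!(DRSL.eqB d.fst (.tag 2) && d.snd.isCons)) = false →
      ∃ x y, d = .cons (.tag 2) (.cons x y) := by
    intro d hd
    simp only [Bool.not_eq_false', Bool.and_eq_true, eqB_eq_true] at hd
    obtain ⟨x, y, h⟩ := Data.isCons_eq_true.mp hd.2
    cases d with
    | nil => simp [Data.snd] at h
    | cons t c => exact ⟨x, y, by rw [← h, ← hd.1]; rfl⟩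
  refine conjunction (leaf := fun d => !(DRSL.eqB d.fst (.tag 2) && d.snd.isCons)) (base := base)
    (l := fun d => d.snd.fst) (r := fun d => d.snd.snd) (by fun_prop) hbase (by fun_prop)
    (by fun_prop) _ ?_ ?_ ?_
  · intro d hd
    rw [Bool.eq_iff_iff, holds_eq_true]
    refine hS₁ d ?_
    rintro ⟨x, y, rfl⟩
    simp at hd
  · intro d hd
    obtain ⟨x, y, rfl⟩ := hsplit d hd
    rw [Bool.eq_iff_iff, Bool.and_eq_true, holds_eq_true, holds_eq_true, holds_eq_true]
    exact hS₂ x y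
  · intro d hd
    obtain ⟨x, y, rfl⟩ := hsplit d hd
    simp
    omega

instance : Recognizable O KLM := ⟨PolyFun.conjunctions
  (base := fun d => d.isCons && ((eqB d.fst (.tag 0) && isEnc Fml d.snd) ||
    (eqB d.fst (.tag 1) && isEnc Cond d.snd))) (by fun_prop) (S := {d | ∃ φ : KLM, enc φ = d})
  (fun d hd => by
    simp only [Bool.and_eq_true, Bool.or_eq_true, eqB_eq_true, isEnc, holds_eq_true,
      Set.mem_ofPred_eq]
    constructor
    · rintro ⟨φ, rfl⟩
      cases φ with
      | bool a => exact ⟨rfl, .inl ⟨rfl, a, rfl⟩⟩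
      | cond c => exact ⟨rfl, .inr ⟨rfl, c, rfl⟩⟩
      | and φ χ => exact absurd ⟨_, _, rfl⟩ hd
    · rintro ⟨hc, h⟩
      obtain ⟨t, c, rfl⟩ := Data.isCons_eq_true.mp hc
      rcases h with ⟨rfl, a, rfl⟩ | ⟨rfl, c, rfl⟩
      · exact ⟨.bool a, rfl⟩
      · exact ⟨.cond c, rfl⟩)
  (fun x y => by
    constructor
    · rintro ⟨φ, h⟩
      cases φ with
      | and φ χ =>
        simp only [enc, KLM.enc, Data.cons.injEq, true_and] at h
        exact ⟨⟨φ, h.1⟩, ⟨χ, h.2⟩⟩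
      | _ => simp [enc, KLM.enc] at h
    · rintro ⟨⟨φ, rfl⟩, ⟨χ, rfl⟩⟩
      exact ⟨.and φ χ, rfl⟩)⟩

instance : Recognizable O Query := ⟨PolyFun.conjunctions
  (base := fun d => d.isCons && ((eqB d.fst (.tag 0) || eqB d.fst (.tag 1)) &&
    isEnc (Standpoint × KLM) d.snd)) (by fun_prop) (S := {d | ∃ ψ : Query, enc ψ = d})
  (fun d hd => by
    simp only [Bool.and_eq_true, Bool.or_eq_true, eqB_eq_true, isEnc, holds_eq_true,
      Set.mem_ofPred_eq]
    constructor
    · rintro ⟨ψ, rfl⟩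
      cases ψ with
      | box s φ => exact ⟨rfl, .inl rfl, (s, φ), rfl⟩
      | dia s φ => exact ⟨rfl, .inr rfl, (s, φ), rfl⟩
      | and φ χ => exact absurd ⟨_, _, rfl⟩ hd
    · rintro ⟨hc, h⟩
      obtain ⟨t, c, rfl⟩ := Data.isCons_eq_true.mp hc
      rcases h with ⟨rfl | rfl, p, rfl⟩
      · exact ⟨.box p.1 p.2, rfl⟩
      · exact ⟨.dia p.1 p.2, rfl⟩)
  (fun x y => by
    constructor
    · rintro ⟨ψ, h⟩
      cases ψ with
      | and φ χ =>
        simp only [enc, Query.enc, Data.cons.injEq, true_and] at h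
        exact ⟨⟨φ, h.1⟩, ⟨χ, h.2⟩⟩
      | _ => simp [enc, Query.enc] at h
    · rintro ⟨⟨φ, rfl⟩, ⟨χ, rfl⟩⟩
      exact ⟨.and φ χ, rfl⟩)⟩

instance : Recognizable O Item := ⟨PolyFun.of_enc
  (g := fun d : Data => d.isCons && (((eqB d.fst (.tag 0) || eqB d.fst (.tag 1)) &&
    isEnc (Standpoint × KLM) d.snd) ||
      (eqB d.fst (.tag 2) && isEnc (Standpoint × Standpoint) d.snd))) (by fun_prop) fun d => by
    congr 1
    rw [Bool.eq_iff_iff]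
    simp only [Bool.and_eq_true, Bool.or_eq_true, eqB_eq_true, isEnc, holds_eq_true]
    constructor
    · rintro ⟨i, rfl⟩
      cases i with
      | box s φ => exact ⟨rfl, .inl ⟨.inl rfl, (s, φ), rfl⟩⟩
      | dia s φ => exact ⟨rfl, .inl ⟨.inr rfl, (s, φ), rfl⟩⟩
      | sharp s t => exact ⟨rfl, .inr ⟨rfl, (s, t), rfl⟩⟩
    · rintro ⟨hc, h⟩
      obtain ⟨t, c, rfl⟩ := Data.isCons_eq_true.mp hc
      rcases h with ⟨rfl | rfl, p, rfl⟩ | ⟨rfl, p, rfl⟩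
      · exact ⟨.box p.1 p.2, rfl⟩
      · exact ⟨.dia p.1 p.2, rfl⟩
      · exact ⟨.sharp p.1 p.2, rfl⟩⟩

end recognizable

/-! ### Decision problems -/

/-- A decision problem on encoded instances is in polynomial time if it has a polynomial-time test
and the encodings can be recognized. -/
theorem mem_polyTimeWith {O : Set Data} {α : Type} [Enc α] [Recognizable O α] {f : α → Bool}
    (hf : PolyFun O f) : {d | ∃ a : α, d = enc a ∧ f a = true} ∈ PolyTimeWith O := by
  obtain ⟨P, p, hP⟩ := hf
  have hL : PolyFun O fun d : Data => holds (∃ a : α, d = enc a ∧ f a = true) := by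
    refine PolyFun.dcond (c := isEnc α) (by fun_prop) ⟨P, p, ?_⟩
      (PolyFun.of_enc (PolyFun.const false) ?_)
    · rintro ⟨d, hd⟩
      obtain ⟨a, rfl⟩ := holds_eq_true.mp hd
      have : holds (∃ b : α, enc a = enc b ∧ f b = true) = f a := by
        rw [Bool.eq_iff_iff, holds_eq_true]
        constructor
        · rintro ⟨b, h, hb⟩
          rwa [enc_injective h]
        · exact fun h => ⟨a, rfl, h⟩
      simp only [this]
      exact hP a
    · rintro ⟨d, hd⟩
      congr 1
      rw [holds_eq_false]
      rintro ⟨a, rfl, _⟩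
      exact holds_eq_false.mp hd ⟨a, rfl⟩
  obtain ⟨Q, q, hQ⟩ := hL
  refine ⟨Q, q, fun d => ?_⟩
  obtain ⟨t, ht, hr⟩ := hQ d
  refine ⟨t, ht, fun hd => ?_, fun hd => ?_⟩
  · have h : holds (∃ a : α, d = enc a ∧ f a = true) = true := holds_eq_true.mpr hd
    simp only [h] at hr
    exact hr
  · have h : holds (∃ a : α, d = enc a ∧ f a = true) = false := holds_eq_false.mpr hd
    simp only [h] at hr
    exact hr

/-! ### Entailment with an oracle -/

/-- The atoms of a formula, listed. -/
def Fml.atoms : Fml → List Name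
  | atom p => [p]
  | bot | top => []
  | neg a => a.atoms
  | and a b | or a b | imp a b | iff a b => a.atoms ++ b.atoms

theorem Fml.eval_congr {v w : Name → Bool} {a : Fml} (h : ∀ p ∈ a.atoms, v p = w p) :
    a.eval v = a.eval w := by
  induction a <;> simp_all [atoms, eval]

theorem Fml.esize_atoms_le (a : Fml) : esize a.atoms ≤ esize a := by
  induction a with
  | atom p => simp [atoms, esize, Data.size_tag]
  | bot => exact esize_pos _
  | top => exact esize_pos _
  | neg a ih => simp [atoms, esize] at *; omega
  | _ a b iha ihb =>
    have := esize_append a.atoms b.atoms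
    simp [atoms, esize] at *; omega

theorem esize_map_le {α β : Type} [Enc α] [Enc β] {f : α → β} {l : List α}
    (h : ∀ a ∈ l, esize (f a) ≤ esize a) : esize (l.map f) ≤ esize l := by
  induction l with
  | nil => exact le_rfl
  | cons a l ih =>
    have h₁ := h a (by simp)
    have h₂ := ih fun b hb => h b (by simp [hb])
    simp only [List.map_cons, esize_cons]
    omega

/-- The instances of non-entailment. -/
def nonEntailment : Set Data :=
  {d | ∃ (E : List Cond) (a : Fml), d = enc (E, a) ∧ ¬Entails E.toFinset a}

/-- A countermodel is a certificate, given by those atoms of the instance that it makes true. -/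
theorem nonEntailment_mem_NPTime : nonEntailment ∈ NPTime := by
  have hR := mem_polyTimeWith (O := ∅) (α := (List Cond × Fml) × List Name)
    (f := fun p => (p.1.1.all fun c => c.mat.evalIn p.2) && !p.1.2.evalIn p.2) (by fun_prop)
  refine ⟨_, hR, .X, fun d => ?_⟩
  simp only [Polynomial.eval_X, Set.mem_ofPred_eq, Bool.and_eq_true, List.all_eq_true,
    Bool.not_eq_true']
  constructor
  · rintro ⟨E, a, rfl, h⟩
    simp only [Entails, not_forall, Bool.not_eq_true] at h
    obtain ⟨v, hE, ha⟩ := h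
    set M : List Name := (E.flatMap (fun c => c.mat.atoms) ++ a.atoms).filter v with hM
    have hval : ∀ b : Fml, (∀ p ∈ b.atoms, p ∈ E.flatMap (fun c => c.mat.atoms) ++ a.atoms) →
        b.evalIn M = b.eval v := fun b hb => Fml.eval_congr fun p hp => by
      rw [Bool.eq_iff_iff, memB_eq_true, hM, List.mem_filter]
      exact ⟨fun h => h.2, fun h => ⟨hb p hp, h⟩⟩
    refine ⟨enc M, ?_, ((E, a), M), rfl, fun c hc => ?_, ?_⟩
    · have h₁ : esize M ≤ _ := esize_sublist List.filter_sublist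
      have h₂ := esize_append (E.flatMap fun c => c.mat.atoms) a.atoms
      have h₃ := a.esize_atoms_le
      have h₄ := esize_flatten_le (E.map fun c => c.mat.atoms)
      have h₅ : esize (E.map fun c => c.mat.atoms) ≤ esize E := esize_map_le fun c _ => by
        have e₁ := c.ante.esize_atoms_le
        have e₂ := c.conc.esize_atoms_le
        have e₃ := esize_append c.ante.atoms c.conc.atoms
        have e₄ : esize c = esize c.ante + esize c.conc + 1 := rfl
        simp only [Cond.mat, Fml.atoms]
        omega
      rw [← List.flatMap_def] at h₄
      change esize M ≤ esize (E, a)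
      rw [esize_pair]
      omega
    · rw [hval _ fun p hp => List.mem_append_left _ (List.mem_flatMap.mpr ⟨c, hc, hp⟩)]
      exact hE c (List.mem_toFinset.mpr hc)
    · rw [hval _ fun p hp => List.mem_append_right _ hp]
      exact ha
  · rintro ⟨w, _, ⟨⟨E, a⟩, M⟩, h, hE, ha⟩
    simp only [enc_pair, Data.cons.injEq] at h
    refine ⟨E, a, h.1, fun hent => ?_⟩
    have := hent (fun p => memB p M) fun c hc => hE c (List.mem_toFinset.mp hc)
    exact Bool.eq_false_iff.mp ha this

theorem PolyFun.query {O : Set Data} : PolyFun O fun d : Data => holds (d ∈ O) := by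
  refine ⟨.query, .X + 3, fun d => ?_⟩
  by_cases h : d ∈ O
  · simp only [holds_eq_true.mpr h]
    exact ⟨_, by simp [esize], .query_yes h⟩
  · simp only [holds_eq_false.mpr h]
    exact ⟨_, by simp [esize], .query_no h⟩

/-- The entailment test that asks an oracle for non-entailment. -/
noncomputable def oracleEntails (p : List Cond × Fml) : Bool := !holds (enc p ∈ nonEntailment)

theorem PolyFun.oracleEntails : PolyFun nonEntailment oracleEntails :=
  (PolyFun.query.comp enc_fun).bnot

theorem decides_oracleEntails : Decides oracleEntails fun _ => True := by
  intro E _ c _ a _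
  rw [oracleEntails, Bool.not_eq_true', holds_eq_false]
  constructor
  · intro h
    by_contra hn
    exact h ⟨E, a, rfl, hn⟩
  · rintro h ⟨E', a', he, hn⟩
    obtain ⟨rfl, rfl⟩ := Prod.mk.inj (enc_injective he)
    exact hn h

/-! ### The complexity of rational closure -/

theorem rcStandpointProblem_mem : rcStandpointProblem ∈ PTimeNP := by
  refine ⟨_, nonEntailment_mem_NPTime, ?_⟩
  convert mem_polyTimeWith (O := nonEntailment) (PolyFun.closedWorldB.band
    (PolyFun.rcStandpointB PolyFun.oracleEntails)) using 1
  ext d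
  have hK : ∀ (K : List Item) (ψ : Query),
      rcStandpointB oracleEntails K ψ = true ↔ RCStandpoint K.toFinset ψ := fun K ψ =>
    rcStandpointB_eq_true decides_oracleEntails (fun _ _ _ _ _ => trivial) (by
      induction ψ with
      | and ψ χ ihψ ihχ => exact ⟨ihψ, ihχ⟩
      | _ s φ => exact fun _ _ => trivial)
  simp only [rcStandpointProblem, Set.mem_ofPred_eq, Bool.and_eq_true, closedWorldB_eq_true, hK,
    Prod.exists]
  rfl

theorem rcPropProblem_mem : rcPropProblem ∈ PTimeNP := by
  refine ⟨_, nonEntailment_mem_NPTime, ?_⟩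
  convert mem_polyTimeWith (O := nonEntailment) (PolyFun.rcPropB (α := List KLM × KLM)
    PolyFun.oracleEntails PolyFun.fst PolyFun.snd) using 1
  ext d
  have hB : ∀ (B : List KLM) (φ : KLM),
      rcPropB oracleEntails B φ = true ↔ RCProp B.toFinset φ := fun B φ =>
    rcPropB_eq_true decides_oracleEntails (fun _ _ _ _ => trivial) (fun _ _ => trivial)
  simp only [rcPropProblem, Set.mem_ofPred_eq, hB, Prod.exists]
  rfl

theorem rcStandpointHornProblem_mem : rcStandpointHornProblem ∈ PTime := by
  unfold PTime
  convert mem_polyTimeWith (O := ∅) ((PolyFun.closedWorldB.band PolyFun.hornInstanceB).band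
    (PolyFun.rcStandpointB PolyFun.hornEntails)) using 1
  ext d
  have hK : ∀ (K : List Item) (ψ : Query), (∀ i ∈ K, i.IsHorn) → ψ.IsHorn →
      (rcStandpointB hornEntails K ψ = true ↔ RCStandpoint K.toFinset ψ) := fun K ψ hK hψ =>
    rcStandpointB_eq_true decides_hornEntails
      (fun i hi his => by
        have := hK i hi
        cases i with
        | sharp s t => simp [Item.isSharp] at his
        | _ => exact this)
      (by
        induction ψ with
        | and ψ χ ihψ ihχ => exact ⟨ihψ hψ.1, ihχ hψ.2⟩
        | _ s φ => exact hψ)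
  simp only [rcStandpointHornProblem, Set.mem_ofPred_eq, Bool.and_eq_true, closedWorldB_eq_true,
    hornInstanceB_eq_true, Prod.exists]
  refine exists₂_congr fun K ψ => and_congr_right fun _ => ?_
  rw [and_assoc, and_assoc]
  refine and_congr_right fun _ => and_congr_right fun h₁ => and_congr_right fun h₂ => ?_
  exact (hK K ψ h₁ h₂).symm

end DRSL

theorem mainTheorem2 :
    (DRSL.rcStandpointProblem ∈ DRSL.PTimeNP ∧ DRSL.rcPropProblem ∈ DRSL.PTimeNP) ∧
      DRSL.rcStandpointHornProblem ∈ DRSL.PTime :=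
  ⟨⟨DRSL.rcStandpointProblem_mem, DRSL.rcPropProblem_mem⟩, DRSL.rcStandpointHornProblem_mem⟩
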